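/- Let $M$ be a finite-dimensional smooth manifold and $G$ a finite-dimensional Lie group with Lie algebra $\mathcal G$, acting smoothly on $M$. Equip $T^*(M)$ with the Liouville 1-form $\lambda$, $\lambda_{(u,\alpha)}(w)=\alpha(d\,pr_M\,w)$, with the symplectic form $\omega=d\lambda$, and with the lifted action $g\circ(u,\alpha)=(g\cdot u,\ \alpha\circ (d_ug)^{-1})$ of $G$. For $a\in\mathcal G$ let $k_a$ and $K_a$ be the vector fields generated by $a$ on $M$ and on $T^*(M)$. Let $l:T^*(M)\to\mathcal G^*$, $\langle l(u,\alpha),a\rangle=\alpha(k_a(u))$, be the momentum mapping, let $\xi\in\mathcal G^*$ be a regular value of $l$ (that is, $d_xl$ is surjective for all $x\in l^{-1}(\xi)$), let $\mathcal M_\xi=l^{-1}(\xi)$, and let $G_\xi=\{g\in G:\ \xi\circ \mathrm{Ad}_{g^{-1}}=\xi\}$ be the stabilizer of $\xi$ for the coadjoint action. Let $f$ be a smooth real function on an open neighbourhood $U\subset T^*(M)$ of $\mathcal M_\xi$ whose restriction to $\mathcal M_\xi$ is $G_\xi$-invariant, and let $K_f$ be its Hamiltonian vector field, $i_{K_f}\omega=-df$.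 For $x\in T^*(M)$ let $Or(G;x)$ and $Or(G_\xi;x)$ denote the orbits of $x$ under $G$ and $G_\xi$, with tangent spaces $T_x(Or(G;x))=\{K_a(x):a\in\mathcal G\}$ and $T_x(Or(G_\xi;x))=\{K_a(x):a\in\mathcal G_\xi\}$, where $\mathcal G_\xi=T_1(G_\xi)$. Theorem. At every point $x\in\mathcal M_\xi$ the vector $K_f(x)$ exists and is unique, and there is a vector $V_f\in T_x(Or(G;x))$ such that $K_f(x)+V_f\in T_x(\mathcal M_\xi)$. Furthermore, $V_f$ is determined uniquely up to a vector tangent to $Or(G_\xi;x)$: a vector $V'\in T_x(Or(G;x))$ satisfies $K_f(x)+V'\in T_x(\mathcal M_\xi)$ if and only if $V'-V_f\in T_x(Or(G_\xi;x))$. -/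

import Mathlib

open Bundle Set Filter
open scoped Manifold ContDiff Topology

noncomputable section

namespace CotangentReduction

section Cotangent

variable (E : Type*) [NormedAddCommGroup E] [NormedSpace ℝ E]
  (M : Type*) [TopologicalSpace M] [ChartedSpace E M] [IsManifold 𝓘(ℝ, E) ∞ M]

/-- The cotangent bundle `T*M` of a smooth manifold `M` modelled on `E`: the total space of the
bundle with fibres `T_uM →L[ℝ] ℝ`, with Mathlib's topology and smooth structure on the total
space of a bundle of continuous linear maps. A point is a pair `⟨u, α⟩` with `α` in the dual of
`T_uM`. -/
abbrev Cotangent : Type _ :=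
  TotalSpace (E →L[ℝ] ℝ) (fun u : M => TangentSpace 𝓘(ℝ, E) u →L[ℝ] Trivial M ℝ u)

/-- The model with corners of `T*M`, with model space `E × E*`. -/
abbrev cotangentModel : ModelWithCorners ℝ (E × (E →L[ℝ] ℝ)) (ModelProd E (E →L[ℝ] ℝ)) :=
  𝓘(ℝ, E).prod 𝓘(ℝ, E →L[ℝ] ℝ)

variable {E M}

/-- The Liouville 1-form `λ` on `T*M`: `λ_(u,α)(w) = α (d pr_M w)`. -/
def liouvilleForm (p : Cotangent E M) : TangentSpace (cotangentModel E) p →L[ℝ] ℝ :=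
  p.2.comp (mfderiv (cotangentModel E) 𝓘(ℝ, E) (fun q : Cotangent E M => q.1) p)

end Cotangent

section Manifold

variable {F : Type*} [NormedAddCommGroup F] [NormedSpace ℝ F]
  {H : Type*} [TopologicalSpace H] (J : ModelWithCorners ℝ F H)
  {X : Type*} [TopologicalSpace X] [ChartedSpace H X]

/-- The pull-back of a 1-form `θ` on `X` by the inverse of the preferred chart at `x`. -/
def oneFormInChart (θ : (x : X) → TangentSpace J x →L[ℝ] ℝ) (x : X) (y : F) : F →L[ℝ] ℝ :=
  (θ ((extChartAt J x).symm y)).comp (mfderiv 𝓘(ℝ, F) J (extChartAt J x).symm y)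

/-- The exterior derivative of a 1-form `θ` on a manifold without boundary, computed at `x` in
the preferred chart at `x`: in a chart, `dθ(v, w) = (D_v θ)(w) - (D_w θ)(v)`. -/
def extDerivOneForm (θ : (x : X) → TangentSpace J x →L[ℝ] ℝ) (x : X)
    (v w : TangentSpace J x) : ℝ :=
  let v' : F := mfderiv J 𝓘(ℝ, F) (extChartAt J x) x v
  let w' : F := mfderiv J 𝓘(ℝ, F) (extChartAt J x) x w
  fderiv ℝ (oneFormInChart J θ x) (extChartAt J x x) v' w'
    - fderiv ℝ (oneFormInChart J θ x) (extChartAt J x x) w' v'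

/-- The set of vectors tangent at `x` to a subset `S` of a manifold `X`: the velocities at time
`0` of the `C¹` curves through `x` that lie in `S`. When `S` is an embedded submanifold this is
its tangent space at `x ∈ S`. -/
def tangentVectors (S : Set X) (x : X) : Set (TangentSpace J x) :=
  {v | ∃ γ : ℝ → X, ContMDiffAt 𝓘(ℝ, ℝ) J 1 γ 0 ∧ (∀ᶠ t in 𝓝 (0 : ℝ), γ t ∈ S) ∧
    (⟨γ 0, mfderiv 𝓘(ℝ, ℝ) J γ 0 (1 : ℝ)⟩ : TangentBundle J X) = ⟨x, v⟩}

end Manifold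

section Symplectic

variable {E : Type*} [NormedAddCommGroup E] [NormedSpace ℝ E]
  {M : Type*} [TopologicalSpace M] [ChartedSpace E M] [IsManifold 𝓘(ℝ, E) ∞ M]

/-- The canonical symplectic form `ω = dλ` on `T*M`. -/
def symplecticForm (p : Cotangent E M) (v w : TangentSpace (cotangentModel E) p) : ℝ :=
  extDerivOneForm (cotangentModel E) liouvilleForm p v w

/-- `K` is the value at `p` of the Hamiltonian vector field of `f`: `i_K ω = -df` at `p`. -/
def IsHamiltonianVector (f : Cotangent E M → ℝ) (p : Cotangent E M)
    (K : TangentSpace (cotangentModel E) p) : Prop :=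
  ∀ w : TangentSpace (cotangentModel E) p,
    symplecticForm p K w = -(mfderiv (cotangentModel E) 𝓘(ℝ, ℝ) f p w : ℝ)

end Symplectic

section Action

variable {E : Type*} [NormedAddCommGroup E] [NormedSpace ℝ E]
  {M : Type*} [TopologicalSpace M] [ChartedSpace E M] [IsManifold 𝓘(ℝ, E) ∞ M]
  {E' : Type*} [NormedAddCommGroup E'] [NormedSpace ℝ E']
  {G : Type*} [TopologicalSpace G] [ChartedSpace E' G] [Group G]

/-- The adjoint action `Ad_g`, the differential at `1` of `h ↦ g h g⁻¹`, as an endomorphism of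
the Lie algebra `T_1G`. The codomain `T_(g1g⁻¹)G` of the differential is `T_1G`, as
`g1g⁻¹ = 1`. -/
def Ad (g : G) : GroupLieAlgebra 𝓘(ℝ, E') G →L[ℝ] GroupLieAlgebra 𝓘(ℝ, E') G :=
  mfderiv 𝓘(ℝ, E') 𝓘(ℝ, E') (fun h : G => g * h * g⁻¹) (1 : G)

/-- The stabilizer `G_ξ` of `ξ ∈ 𝔤*` for the coadjoint action `(g, ξ) ↦ ξ ∘ Ad_(g⁻¹)`. Here the
dual `𝔤*` is written `E' →L[ℝ] ℝ`, since `𝔤 = T_1G` is the model space `E'` of `G`; in this form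
it carries the structure of a normed space. -/
def coadjointStabilizer (ξ : E' →L[ℝ] ℝ) : Set G :=
  {g | ∀ a : GroupLieAlgebra 𝓘(ℝ, E') G, ξ (Ad g⁻¹ a) = ξ a}

variable [MulAction G M]

/-- The lift of the diffeomorphism `u ↦ g • u` of `M` to `T*M`:
`(u, α) ↦ (g • u, α ∘ (d_u g)⁻¹)`. -/
def cotangentLift (g : G) (p : Cotangent E M) : Cotangent E M :=
  ⟨g • p.1, p.2.comp (mfderiv 𝓘(ℝ, E) 𝓘(ℝ, E) (fun u : M => g • u) p.1).inverse⟩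

/-- The linear map `𝔤 → T_uM`, `a ↦ k_a(u)`, of the vector fields on `M` generated by the
action: the differential at `1` of `g ↦ g • u`. The codomain `T_(1•u)M` of the differential is
`T_uM`, as `1 • u = u`. -/
def generator (E' : Type*) [NormedAddCommGroup E'] [NormedSpace ℝ E']
    (G : Type*) [TopologicalSpace G] [ChartedSpace E' G] [Group G] [MulAction G M] (u : M) :
    GroupLieAlgebra 𝓘(ℝ, E') G →L[ℝ] TangentSpace 𝓘(ℝ, E) u :=
  mfderiv 𝓘(ℝ, E') 𝓘(ℝ, E) (fun g : G => g • u) (1 : G)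

/-- The linear map `𝔤 → T_p(T*M)`, `a ↦ K_a(p)`, of the vector fields on `T*M` generated by the
lifted action: the differential at `1` of `g ↦ g • p`. The codomain `T_(1•p)(T*M)` of the
differential is `T_p(T*M)`, as `1 • p = p`. -/
def liftedGenerator (E' : Type*) [NormedAddCommGroup E'] [NormedSpace ℝ E']
    (G : Type*) [TopologicalSpace G] [ChartedSpace E' G] [Group G] [MulAction G M]
    (p : Cotangent E M) :
    GroupLieAlgebra 𝓘(ℝ, E') G →L[ℝ] TangentSpace (cotangentModel E) p :=
  mfderiv 𝓘(ℝ, E') (cotangentModel E) (fun g : G => cotangentLift g p) (1 : G)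

/-- The momentum mapping `l : T*M → 𝔤*`, `⟨l(u, α), a⟩ = α (k_a(u))`. -/
def momentumMap (E' : Type*) [NormedAddCommGroup E'] [NormedSpace ℝ E']
    (G : Type*) [TopologicalSpace G] [ChartedSpace E' G] [Group G] [MulAction G M]
    (p : Cotangent E M) : E' →L[ℝ] ℝ :=
  p.2.comp (generator E' G p.1)

/-- The level set `M_ξ = l⁻¹(ξ)` of the momentum mapping. -/
def levelSet (G : Type*) [TopologicalSpace G] [ChartedSpace E' G] [Group G] [MulAction G M]
    (ξ : E' →L[ℝ] ℝ) : Set (Cotangent E M) :=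
  {p | momentumMap E' G p = ξ}

/-- `ξ` is a regular value of the momentum mapping: the differential of `l` is surjective at
every point of `l⁻¹(ξ)`. -/
def IsRegularValue (E : Type*) [NormedAddCommGroup E] [NormedSpace ℝ E]
    (M : Type*) [TopologicalSpace M] [ChartedSpace E M] [IsManifold 𝓘(ℝ, E) ∞ M]
    (G : Type*) [TopologicalSpace G] [ChartedSpace E' G] [Group G] [MulAction G M]
    (ξ : E' →L[ℝ] ℝ) : Prop :=
  ∀ p ∈ (levelSet G ξ : Set (Cotangent E M)), Function.Surjective
    (mfderiv (cotangentModel E) 𝓘(ℝ, E' →L[ℝ] ℝ)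
      (fun q : Cotangent E M => momentumMap E' G q) p)

/-- The space of vectors tangent at `p` to the orbit of `p` under a set `S` of elements of `G`
(a Lie subgroup): the image of the vectors tangent to `S` at `1` under the differential
`a ↦ K_a(p)` of the orbit map. -/
def orbitTangent (E' : Type*) [NormedAddCommGroup E'] [NormedSpace ℝ E']
    {G : Type*} [TopologicalSpace G] [ChartedSpace E' G] [Group G] [MulAction G M]
    (S : Set G) (p : Cotangent E M) :
    Set (TangentSpace (cotangentModel E) p) :=
  liftedGenerator E' G p '' tangentVectors 𝓘(ℝ, E') S (1 : G)

end Action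

end CotangentReduction

end

/-!
The vectors `K_f(x)` and `V_f` are found by linear algebra in `T_x(T*M)`. Four facts reduce the
theorem to it.

* In the chart `(y, η)` of `T*M` induced by a chart of `M`, the Liouville form is `η dy`, so `dλ` is
  the standard symplectic form `((v, b), (w, c)) ↦ b w - c v` (`symplecticForm_apply`). It is
  nondegenerate, which gives the existence and uniqueness of `K_f(x)`
  (`existsUnique_standardSymplectic_eq`).
* The generators of the lifted action satisfy `i_{K_a} ω = -d⟨l, a⟩`
  (`standardSymplectic_orbitDeriv`). In charts this is a computation with the action
  `ψ(s, y)` of `G` on `M`, which comes down to the symmetry of the second derivative of `ψ`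
  (`standardSymplectic_fderiv_localLift`).
* As `ξ` is a regular value, `T_x(M_ξ)` is the kernel of `d_x l`: the inverse function theorem
  yields a curve in `M_ξ` for every vector in the kernel (`tangentVectors_levelSet`).
* `T_1(G_ξ)` is the kernel of `a ↦ d_x l(K_a(x))` (`tangentVectors_coadjointStabilizer`). By the
  equivariance `l(g • q) = l(q) ∘ Ad_(g⁻¹)`, the stabilizer consists of the `g` with `l(g • x) = ξ`.
  If the derivative of `g ↦ l(g • x)` at `1` vanishes on `a`, then by equivariance again it vanishes
  on the left-invariant vector field of `a`, and the integral curve of that field through `1`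
  stays in `G_ξ`. This avoids the exponential map and the closed subgroup theorem.

Now `A a b = d_x l(K_a(x)) b` equals `ω(K_a, K_b)`, hence `A` is antisymmetric, and its range is the
annihilator of its kernel `T_1(G_ξ)`. On this kernel `d_x l(K_f)` vanishes, since
`d_x l(K_f) a = ω(K_f, K_a) = -df(K_a)` and `f` is constant along the `G_ξ`-orbit of `x`. So
there is an `a` with `A a = -d_x l(K_f)`, that is, `K_f + K_a` is in `T_x(M_ξ)`. Two
solutions differ by some `K_b` with `A b = 0`, that is, with `b` in `T_1(G_ξ)`.

The tangent space of a manifold at a point is by definition the model space, and the preferred chart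
at a point has derivative the identity there. Most differentials below are therefore stated as maps
between model spaces.
-/

noncomputable section

namespace CotangentReduction

/-! ### Derivatives read in preferred charts -/

section ChartDerivative

variable {F₁ : Type*} [NormedAddCommGroup F₁] [NormedSpace ℝ F₁]
  {H₁ : Type*} [TopologicalSpace H₁] {J₁ : ModelWithCorners ℝ F₁ H₁}
  {X₁ : Type*} [TopologicalSpace X₁] [ChartedSpace H₁ X₁]
  {F₂ : Type*} [NormedAddCommGroup F₂] [NormedSpace ℝ F₂]
  {H₂ : Type*} [TopologicalSpace H₂] {J₂ : ModelWithCorners ℝ F₂ H₂}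
  {X₂ : Type*} [TopologicalSpace X₂] [ChartedSpace H₂ X₂]

/-- If a 1-form is linear in the preferred chart at `x`, say `y ↦ A y`, then its exterior derivative
at `x` is `A v w - A w v`: the chart has derivative the identity at its own base point. -/
theorem extDerivOneForm_of_oneFormInChart_eventuallyEq [IsManifold J₁ 1 X₁]
    {θ : (x : X₁) → TangentSpace J₁ x →L[ℝ] ℝ}
    {x : X₁} {A : F₁ →L[ℝ] (F₁ →L[ℝ] ℝ)}
    (hA : oneFormInChart J₁ θ x =ᶠ[𝓝 (extChartAt J₁ x x)] A) (v w : F₁) :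
    extDerivOneForm J₁ θ x v w = A v w - A w v := by
  simp only [extDerivOneForm, (A.hasFDerivAt.congr_of_eventuallyEq hA).fderiv,
    mfderiv_extChartAt_self]
  rfl

variable [J₁.Boundaryless]

/-- The manifold derivative can be read off from any map `Φ` of the model spaces that represents `h`
near `x` in the preferred charts at `x` and `h x`. -/
theorem hasMFDerivAt_of_eventually_chart {h : X₁ → X₂} {x : X₁} {Φ : F₁ → F₂} {Φ' : F₁ →L[ℝ] F₂}
    (hh : ∀ᶠ x' in 𝓝 x, h x' ∈ (extChartAt J₂ (h x)).source ∧
      extChartAt J₂ (h x) (h x') = Φ (extChartAt J₁ x x'))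
    (hΦ : HasFDerivAt Φ Φ' (extChartAt J₁ x x)) :
    HasMFDerivAt J₁ J₂ h x Φ' := by
  have hx := hh.self_of_nhds
  refine ⟨?_, ?_⟩
  · have h1 : h =ᶠ[𝓝 x] fun x' => (extChartAt J₂ (h x)).symm (Φ (extChartAt J₁ x x')) := by
      filter_upwards [hh] with x' hx'
      rw [← hx'.2, (extChartAt J₂ (h x)).left_inv hx'.1]
    refine ContinuousAt.congr ?_ h1.symm
    refine ContinuousAt.comp (g := (extChartAt J₂ (h x)).symm) ?_
      (ContinuousAt.comp (g := Φ) hΦ.continuousAt (continuousAt_extChartAt x))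
    rw [← hx.2]
    exact continuousAt_extChartAt_symm (h x)
  · rw [J₁.range_eq_univ]
    refine HasFDerivAt.hasFDerivWithinAt (E := F₁) (F := F₂) ?_
    refine hΦ.congr_of_eventuallyEq ?_
    have h2 : Tendsto (extChartAt J₁ x).symm (𝓝 (extChartAt J₁ x x)) (𝓝 x) := by
      have := continuousAt_extChartAt_symm (I := J₁) x
      rwa [ContinuousAt, extChartAt_to_inv] at this
    filter_upwards [h2.eventually hh, extChartAt_target_mem_nhds (I := J₁) x] with z hz hz'
    rw [writtenInExtChartAt, Function.comp_apply, Function.comp_apply, hz.2,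
      (extChartAt J₁ x).right_inv hz']

variable [IsManifold J₁ 1 X₁]

theorem mdifferentiableAt_extChartAt_symm {x : X₁} {z : F₁} (hz : z ∈ (extChartAt J₁ x).target) :
    MDifferentiableAt 𝓘(ℝ, F₁) J₁ (extChartAt J₁ x).symm z := by
  have := mdifferentiableWithinAt_extChartAt_symm hz
  rwa [J₁.range_eq_univ, mdifferentiableWithinAt_univ] at this

theorem mfderiv_extChartAt_symm_self (x : X₁) :
    mfderiv 𝓘(ℝ, F₁) J₁ (extChartAt J₁ x).symm (extChartAt J₁ x x) =
      ContinuousLinearMap.id ℝ F₁ := by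
  have := mfderivWithin_range_extChartAt_symm (I := J₁) (x := x)
  rwa [J₁.range_eq_univ, mfderivWithin_univ] at this

end ChartDerivative

/-! ### The Liouville form and the symplectic form in a chart of the cotangent bundle -/

section CotangentChart

variable {E : Type*} [NormedAddCommGroup E] [NormedSpace ℝ E]
  {M : Type*} [TopologicalSpace M] [ChartedSpace E M] [IsManifold 𝓘(ℝ, E) ∞ M]

theorem mem_extChartAt_cotangent_source {p q : Cotangent E M} :
    q ∈ (extChartAt (cotangentModel E) p).source ↔ q.1 ∈ (extChartAt 𝓘(ℝ, E) p.1).source := by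
  simp only [extChartAt_source, FiberBundle.chartedSpace_chartAt]
  simp only [OpenPartialHomeomorph.trans_source, OpenPartialHomeomorph.prod_source,
    OpenPartialHomeomorph.refl_source, mem_inter_iff, mem_preimage, mem_prod, mem_univ, and_true]
  have h1 : q ∈ (trivializationAt (E →L[ℝ] ℝ)
      (fun u : M => TangentSpace 𝓘(ℝ, E) u →L[ℝ] Trivial M ℝ u) p.1).toOpenPartialHomeomorph.source
        ↔ q.1 ∈ (chartAt E p.1).source := by
    rw [Trivialization.mem_source]
    simp
  constructor
  · exact fun h => h1.1 h.1
  · intro h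
    refine ⟨h1.2 h, ?_⟩
    have := (trivializationAt (E →L[ℝ] ℝ)
      (fun u : M => TangentSpace 𝓘(ℝ, E) u →L[ℝ] Trivial M ℝ u) p.1).coe_fst (h1.2 h)
    rw [← this] at h
    exact h

/-- The preferred chart of `T*M` at `p` is the chart `(y, η)` induced by the preferred chart of `M`
at the base point of `p`: the covector is pulled back by the inverse of the latter. -/
theorem extChartAt_cotangent_apply {p q : Cotangent E M}
    (hq : q.1 ∈ (extChartAt 𝓘(ℝ, E) p.1).source) :
    extChartAt (cotangentModel E) p q = (extChartAt 𝓘(ℝ, E) p.1 q.1,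
      q.2.comp (mfderiv 𝓘(ℝ, E) 𝓘(ℝ, E) (extChartAt 𝓘(ℝ, E) p.1).symm
        (extChartAt 𝓘(ℝ, E) p.1 q.1))) := by
  rw [extChartAt_source] at hq
  have h1 : extChartAt (cotangentModel E) p q = chartAt (ModelProd E (E →L[ℝ] ℝ)) p q := rfl
  rw [h1, hom_chart]
  have h2 := TangentBundle.symmL_trivializationAt (I := 𝓘(ℝ, E)) hq
  rw [𝓘(ℝ, E).range_eq_univ, mfderivWithin_univ] at h2
  refine Prod.ext rfl ?_
  simp only [ContinuousLinearMap.inCoordinates]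
  rw [h2]
  ext v
  simp
  rfl

theorem extChartAt_cotangent_self (p : Cotangent E M) :
    extChartAt (cotangentModel E) p p = (extChartAt 𝓘(ℝ, E) p.1 p.1, p.2) := by
  rw [extChartAt_cotangent_apply (mem_extChartAt_source _), mfderiv_extChartAt_symm_self]
  rfl

theorem proj_extChartAt_cotangent_symm {p : Cotangent E M} {z : E × (E →L[ℝ] ℝ)}
    (hz : z ∈ (extChartAt (cotangentModel E) p).target) :
    ((extChartAt (cotangentModel E) p).symm z).1 = (extChartAt 𝓘(ℝ, E) p.1).symm z.1 := by
  have hqs := mem_extChartAt_cotangent_source.1 ((extChartAt (cotangentModel E) p).map_target hz)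
  have hqz := (extChartAt (cotangentModel E) p).right_inv hz
  rw [extChartAt_cotangent_apply hqs] at hqz
  rw [← congrArg Prod.fst hqz, (extChartAt 𝓘(ℝ, E) p.1).left_inv hqs]

/-- In the coordinates `(y, η)` the Liouville form is `η dy`. -/
theorem oneFormInChart_liouvilleForm {p : Cotangent E M} {z : E × (E →L[ℝ] ℝ)}
    (hz : z ∈ (extChartAt (cotangentModel E) p).target) :
    oneFormInChart (cotangentModel E) liouvilleForm p z =
      z.2.comp (ContinuousLinearMap.fst ℝ E (E →L[ℝ] ℝ)) := by
  set q := (extChartAt (cotangentModel E) p).symm z with hq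
  have hqs : q ∈ (extChartAt (cotangentModel E) p).source :=
    (extChartAt (cotangentModel E) p).map_target hz
  have hqs1 := mem_extChartAt_cotangent_source.1 hqs
  have hqz : extChartAt (cotangentModel E) p q = z := (extChartAt (cotangentModel E) p).right_inv hz
  rw [extChartAt_cotangent_apply hqs1] at hqz
  have hz1 : extChartAt 𝓘(ℝ, E) p.1 q.1 = z.1 := congrArg Prod.fst hqz
  have hz2 := congrArg Prod.snd hqz
  have hz1t : z.1 ∈ (extChartAt 𝓘(ℝ, E) p.1).target := by
    rw [← hz1]; exact (extChartAt 𝓘(ℝ, E) p.1).map_source hqs1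
  have hproj : MDifferentiableAt (cotangentModel E) 𝓘(ℝ, E) (fun q : Cotangent E M => q.1) q :=
    (contMDiffAt_proj (n := 1) _).mdifferentiableAt one_ne_zero
  have hsymm := mdifferentiableAt_extChartAt_symm hz
  -- the projection to `M` read in the charts is the first projection, so the differential of
  -- `pr_M ∘ (chart)⁻¹` is computed in two ways
  have hcomp : HasMFDerivAt 𝓘(ℝ, E × (E →L[ℝ] ℝ)) 𝓘(ℝ, E)
      (fun z => ((extChartAt (cotangentModel E) p).symm z).1) z
      ((mfderiv 𝓘(ℝ, E) 𝓘(ℝ, E) (extChartAt 𝓘(ℝ, E) p.1).symm z.1).comp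
        (ContinuousLinearMap.fst ℝ E (E →L[ℝ] ℝ))) := by
    have h1 : HasMFDerivAt 𝓘(ℝ, E × (E →L[ℝ] ℝ)) 𝓘(ℝ, E) Prod.fst z
        (ContinuousLinearMap.fst ℝ E (E →L[ℝ] ℝ)) := hasFDerivAt_fst.hasMFDerivAt
    refine ((mdifferentiableAt_extChartAt_symm hz1t).hasMFDerivAt.comp z
      h1).congr_of_eventuallyEq ?_
    filter_upwards [(isOpen_extChartAt_target p).mem_nhds hz] with z' hz'
    exact proj_extChartAt_cotangent_symm hz'
  have hcomp' := hasMFDerivAt_unique (hproj.hasMFDerivAt.comp z hsymm.hasMFDerivAt) hcomp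
  refine ContinuousLinearMap.ext fun v => ?_
  have hv := congrArg (fun T => q.2 (T v)) hcomp'
  refine hv.trans ?_
  rw [← hz2, hz1]
  rfl

/-- In the tangent space at `p`, identified with `E × E*` by the preferred chart at `p`, the form
`dλ` is the standard symplectic form: the chart has derivative the identity at `p`. -/
theorem symplecticForm_apply (p : Cotangent E M) (v w : E × (E →L[ℝ] ℝ)) :
    symplecticForm p v w = v.2 w.1 - w.2 v.1 := by
  let A : E × (E →L[ℝ] ℝ) →L[ℝ] (E × (E →L[ℝ] ℝ) →L[ℝ] ℝ) :=
    ((ContinuousLinearMap.compL ℝ (E × (E →L[ℝ] ℝ)) E ℝ).flip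
      (ContinuousLinearMap.fst ℝ E (E →L[ℝ] ℝ))).comp (ContinuousLinearMap.snd ℝ E (E →L[ℝ] ℝ))
  have hA : oneFormInChart (cotangentModel E) liouvilleForm p
      =ᶠ[𝓝 (extChartAt (cotangentModel E) p p)] A := by
    filter_upwards [extChartAt_target_mem_nhds (I := cotangentModel E) p] with z hz
    exact oneFormInChart_liouvilleForm hz
  exact extDerivOneForm_of_oneFormInChart_eventuallyEq hA v w

/-- The standard symplectic form on `E × E*` is nondegenerate. -/
theorem existsUnique_standardSymplectic_eq [FiniteDimensional ℝ E]
    (θ : E × (E →L[ℝ] ℝ) →L[ℝ] ℝ) :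
    ∃! K : E × (E →L[ℝ] ℝ), ∀ w : E × (E →L[ℝ] ℝ), K.2 w.1 - w.2 K.1 = θ w := by
  -- reflexivity of the finite-dimensional space `E` gives the first component
  obtain ⟨y, hy⟩ := (Module.evalEquiv ℝ E).surjective
    ((θ.comp (ContinuousLinearMap.inr ℝ E (E →L[ℝ] ℝ))).toLinearMap.comp
      (LinearMap.toContinuousLinearMap (𝕜 := ℝ) (E := E) (F' := ℝ)).toLinearMap)
  have hy' (c : E →L[ℝ] ℝ) : c y = θ (0, c) := by
    have := LinearMap.congr_fun hy c.toLinearMap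
    exact this
  refine ⟨(-y, θ.comp (ContinuousLinearMap.inl ℝ E (E →L[ℝ] ℝ))), fun w => ?_, fun K hK => ?_⟩
  · have : θ w = θ (w.1, 0) + θ (0, w.2) := by rw [← map_add]; simp
    simp [this, hy']
  · refine Prod.ext ?_ ?_
    · refine (SeparatingDual.eq_iff_forall_dual_eq (R := ℝ)).2 fun c => ?_
      have := hK (0, c)
      simp only [map_zero, zero_sub] at this
      simp [hy', ← this]
    · ext v
      simpa using hK (v, 0)

end CotangentChart

/-! ### The lift of a local action on a vector space and its momentum map -/

section LocalAction

variable {E : Type*} [NormedAddCommGroup E] [NormedSpace ℝ E]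
  {E' : Type*} [NormedAddCommGroup E'] [NormedSpace ℝ E']

/-- The momentum map of a local action `ψ` on `E`, in the coordinates `(y, η)` of `E × E*`:
`a ↦ η (D₁ψ(s₀, y) a)`. -/
def localMomentum (ψ : E' × E → E) (s₀ : E') (z : E × (E →L[ℝ] ℝ)) : E' →L[ℝ] ℝ :=
  z.2.comp ((fderiv ℝ ψ (s₀, z.1)).comp (ContinuousLinearMap.inl ℝ E' E))

/-- The orbit map at `z` of the cotangent lift of a local action `ψ` on `E`, in the coordinates
`(y, η)` of `E × E*`: `s ↦ (ψ(s, y), η ∘ D₂ψ(s, y)⁻¹)`. -/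
def localLift (ψ : E' × E → E) (z : E × (E →L[ℝ] ℝ)) (s : E') : E × (E →L[ℝ] ℝ) :=
  (ψ (s, z.1), z.2.comp ((fderiv ℝ ψ (s, z.1)).comp (ContinuousLinearMap.inr ℝ E' E)).inverse)

variable {ψ : E' × E → E} {s₀ : E'} {z₀ : E × (E →L[ℝ] ℝ)}

theorem fderiv_comp_inr_eq_id (hψ : DifferentiableAt ℝ ψ (s₀, z₀.1))
    (hid : ∀ᶠ y in 𝓝 z₀.1, ψ (s₀, y) = y) :
    (fderiv ℝ ψ (s₀, z₀.1)).comp (ContinuousLinearMap.inr ℝ E' E) =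
      ContinuousLinearMap.id ℝ E := by
  have h1 : HasFDerivAt (fun y => ψ (s₀, y))
      ((fderiv ℝ ψ (s₀, z₀.1)).comp (ContinuousLinearMap.inr ℝ E' E)) z₀.1 :=
    hψ.hasFDerivAt.comp z₀.1 (hasFDerivAt_prodMk_right s₀ z₀.1)
  exact h1.unique ((hasFDerivAt_id z₀.1).congr_of_eventuallyEq hid)

theorem contDiffAt_localMomentum (hψ : ContDiffAt ℝ ∞ ψ (s₀, z₀.1)) :
    ContDiffAt ℝ ∞ (localMomentum ψ s₀) z₀ := by
  have h1 : ContDiffAt ℝ ∞ (fderiv ℝ ψ) (s₀, z₀.1) := hψ.fderiv_right (by simp)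
  have h2 : ContDiffAt ℝ ∞ (fun z : E × (E →L[ℝ] ℝ) => fderiv ℝ ψ (s₀, z.1)) z₀ :=
    ContDiffAt.comp z₀ h1 (contDiffAt_const.prodMk contDiffAt_fst)
  exact contDiffAt_snd.clm_comp (h2.clm_comp contDiffAt_const)

theorem contDiffAt_localLift [CompleteSpace E] (hψ : ContDiffAt ℝ ∞ ψ (s₀, z₀.1))
    (hid : ∀ᶠ y in 𝓝 z₀.1, ψ (s₀, y) = y) :
    ContDiffAt ℝ ∞ (localLift ψ z₀) s₀ := by
  have hs : ContDiffAt ℝ ∞ (fun s : E' => (s, z₀.1)) s₀ := contDiffAt_id.prodMk contDiffAt_const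
  have h1 : ContDiffAt ℝ ∞ (fderiv ℝ ψ) (s₀, z₀.1) := hψ.fderiv_right (by simp)
  have h2 : ContDiffAt ℝ ∞
      (fun s => (fderiv ℝ ψ (s, z₀.1)).comp (ContinuousLinearMap.inr ℝ E' E)) s₀ :=
    (ContDiffAt.comp s₀ h1 hs).clm_comp contDiffAt_const
  have h3 : ContDiffAt ℝ ∞ ContinuousLinearMap.inverse
      ((fderiv ℝ ψ (s₀, z₀.1)).comp (ContinuousLinearMap.inr ℝ E' E)) := by
    rw [fderiv_comp_inr_eq_id (hψ.differentiableAt (by simp)) hid]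
    exact contDiffAt_map_inverse (ContinuousLinearEquiv.refl ℝ E)
  have h4 := ContDiffAt.comp s₀ h3 h2
  exact (ContDiffAt.comp s₀ hψ hs).prodMk (contDiffAt_const.clm_comp h4)

/-- The two terms come from the second component `η` and from the base point `y`, on which
`D₁ψ(s₀, y)` depends. -/
theorem fderiv_localMomentum_apply (hψ : ContDiffAt ℝ ∞ ψ (s₀, z₀.1))
    (w : E × (E →L[ℝ] ℝ)) (a : E') :
    fderiv ℝ (localMomentum ψ s₀) z₀ w a =
      w.2 (fderiv ℝ ψ (s₀, z₀.1) (a, 0)) +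
        z₀.2 (fderiv ℝ (fderiv ℝ ψ) (s₀, z₀.1) (0, w.1) (a, 0)) := by
  have h1 : ContDiffAt ℝ ∞ (fderiv ℝ ψ) (s₀, z₀.1) := hψ.fderiv_right (by simp)
  have h2 : HasFDerivAt (fun z : E × (E →L[ℝ] ℝ) => fderiv ℝ ψ (s₀, z.1))
      ((fderiv ℝ (fderiv ℝ ψ) (s₀, z₀.1)).comp ((ContinuousLinearMap.inr ℝ E' E).comp
        (ContinuousLinearMap.fst ℝ E (E →L[ℝ] ℝ)))) z₀ :=
    (h1.differentiableAt (by simp)).hasFDerivAt.comp z₀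
      ((hasFDerivAt_prodMk_right s₀ z₀.1).comp z₀ hasFDerivAt_fst)
  have h3 : HasFDerivAt (fun z => localMomentum ψ s₀ z a) _ z₀ :=
    (hasFDerivAt_snd (𝕜 := ℝ) (p := z₀)).clm_apply
      (h2.clm_apply (hasFDerivAt_const ((a, 0) : E' × E) z₀))
  have h4 : HasFDerivAt (fun z => localMomentum ψ s₀ z a)
      ((ContinuousLinearMap.apply ℝ ℝ a).comp (fderiv ℝ (localMomentum ψ s₀) z₀)) z₀ :=
    (ContinuousLinearMap.apply ℝ ℝ a).hasFDerivAt.comp z₀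
      ((contDiffAt_localMomentum hψ).differentiableAt (by simp)).hasFDerivAt
  have h5 := congrArg (fun T => T w) (h4.unique h3)
  simp at h5
  rw [h5]; ring

theorem fderiv_localLift_fst [CompleteSpace E] (hψ : ContDiffAt ℝ ∞ ψ (s₀, z₀.1))
    (hid : ∀ᶠ y in 𝓝 z₀.1, ψ (s₀, y) = y) (a : E') :
    (fderiv ℝ (localLift ψ z₀) s₀ a).1 = fderiv ℝ ψ (s₀, z₀.1) (a, 0) := by
  have h1 : HasFDerivAt (fun s => ψ (s, z₀.1))
      ((fderiv ℝ ψ (s₀, z₀.1)).comp (ContinuousLinearMap.inl ℝ E' E)) s₀ :=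
    (hψ.differentiableAt (by simp)).hasFDerivAt.comp s₀ (hasFDerivAt_prodMk_left s₀ z₀.1)
  have h2 := ((contDiffAt_localLift hψ hid).differentiableAt (by simp)).hasFDerivAt.fst
  exact congrArg (fun T => T a) (h2.unique h1)

/-- Differentiate the relation `η(s) ∘ D₂ψ(s, y) = η`, which defines the second component `η(s)` of
the lifted orbit, at `s₀`, where `D₂ψ(s₀, y) = id`. -/
theorem fderiv_localLift_snd_apply [CompleteSpace E] (hψ : ContDiffAt ℝ ∞ ψ (s₀, z₀.1))
    (hid : ∀ᶠ y in 𝓝 z₀.1, ψ (s₀, y) = y) (a : E') (w : E) :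
    (fderiv ℝ (localLift ψ z₀) s₀ a).2 w =
      - z₀.2 (fderiv ℝ (fderiv ℝ ψ) (s₀, z₀.1) (a, 0) (0, w)) := by
  have h0 := fderiv_comp_inr_eq_id (hψ.differentiableAt (by simp)) hid
  have h1 : ContDiffAt ℝ ∞ (fderiv ℝ ψ) (s₀, z₀.1) := hψ.fderiv_right (by simp)
  have h2 : HasFDerivAt (fun s => fderiv ℝ ψ (s, z₀.1))
      ((fderiv ℝ (fderiv ℝ ψ) (s₀, z₀.1)).comp (ContinuousLinearMap.inl ℝ E' E)) s₀ :=
    (h1.differentiableAt (by simp)).hasFDerivAt.comp s₀ (hasFDerivAt_prodMk_left s₀ z₀.1)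
  have h3 := ((contDiffAt_localLift hψ hid).differentiableAt (by simp)).hasFDerivAt.snd
  have h4 := h3.clm_apply (h2.clm_apply (hasFDerivAt_const ((0, w) : E' × E) s₀))
  -- the relation needs `D₂ψ(s, y)` to be invertible, as `inverse` is zero on other maps; this holds
  -- for `s` near `s₀`, since the invertible maps form an open set
  have h5 : ∀ᶠ s in 𝓝 s₀, (localLift ψ z₀ s).2 (fderiv ℝ ψ (s, z₀.1) (0, w)) = z₀.2 w := by
    have hc : ContinuousAt
        (fun s => (fderiv ℝ ψ (s, z₀.1)).comp (ContinuousLinearMap.inr ℝ E' E)) s₀ :=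
      h2.continuousAt.clm_comp continuousAt_const
    have ho : ∀ᶠ s in 𝓝 s₀, (fderiv ℝ ψ (s, z₀.1)).comp (ContinuousLinearMap.inr ℝ E' E) ∈
        range ((↑) : (E ≃L[ℝ] E) → E →L[ℝ] E) := by
      refine hc.eventually (ContinuousLinearEquiv.isOpen.mem_nhds ?_)
      exact ⟨ContinuousLinearEquiv.refl ℝ E, h0.symm⟩
    filter_upwards [ho] with s hs
    obtain ⟨e, he⟩ := hs
    have h6 : fderiv ℝ ψ (s, z₀.1) (0, w) = e w := by
      rw [← ContinuousLinearEquiv.coe_coe, he]; simp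
    simp [localLift, ← he, h6]
  have h6 := congrArg (fun T => T a)
    (h4.unique ((hasFDerivAt_const (z₀.2 w) s₀).congr_of_eventuallyEq h5))
  have h7 : fderiv ℝ ψ (s₀, z₀.1) (0, w) = w := by
    simpa using congrArg (fun T => T w) h0
  simp [h7, localLift, h0] at h6
  linarith

/-- In coordinates, the vector fields generated by the lifted action are the Hamiltonian vector
fields of the components of the momentum map; the mixed second derivatives of `ψ` agree. -/
theorem standardSymplectic_fderiv_localLift [CompleteSpace E] (hψ : ContDiffAt ℝ ∞ ψ (s₀, z₀.1))
    (hid : ∀ᶠ y in 𝓝 z₀.1, ψ (s₀, y) = y) (a : E') (w : E × (E →L[ℝ] ℝ)) :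
    (fderiv ℝ (localLift ψ z₀) s₀ a).2 w.1 - w.2 (fderiv ℝ (localLift ψ z₀) s₀ a).1 =
      - fderiv ℝ (localMomentum ψ s₀) z₀ w a := by
  rw [fderiv_localMomentum_apply hψ, fderiv_localLift_fst hψ hid, fderiv_localLift_snd_apply hψ hid,
    (hψ.isSymmSndFDerivAt (by simpa using! ENat.LEInfty.out)).eq (a, 0) (0, w.1)]
  ring

end LocalAction

/-! ### The action and its lift in preferred charts -/

section Charts

variable {F₁ : Type*} [NormedAddCommGroup F₁] [NormedSpace ℝ F₁]
  {H₁ : Type*} [TopologicalSpace H₁] {J₁ : ModelWithCorners ℝ F₁ H₁}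
  {X₁ : Type*} [TopologicalSpace X₁] [ChartedSpace H₁ X₁] [IsManifold J₁ 1 X₁] [J₁.Boundaryless]

theorem mfderiv_extChartAt_symm_comp {x y : X₁} (hy : y ∈ (extChartAt J₁ x).source) :
    (mfderiv 𝓘(ℝ, F₁) J₁ (extChartAt J₁ x).symm (extChartAt J₁ x y)).comp
      (mfderiv J₁ 𝓘(ℝ, F₁) (extChartAt J₁ x) y) = ContinuousLinearMap.id ℝ F₁ := by
  have := mfderivWithin_extChartAt_symm_comp_mfderiv_extChartAt' hy
  rw [J₁.range_eq_univ, mfderivWithin_univ] at this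
  exact this

theorem mfderiv_extChartAt_comp_symm {x y : X₁} (hy : y ∈ (extChartAt J₁ x).source) :
    (mfderiv J₁ 𝓘(ℝ, F₁) (extChartAt J₁ x) y).comp
      (mfderiv 𝓘(ℝ, F₁) J₁ (extChartAt J₁ x).symm (extChartAt J₁ x y)) =
      ContinuousLinearMap.id ℝ F₁ := by
  have := mfderiv_extChartAt_comp_mfderivWithin_extChartAt_symm' hy
  rw [J₁.range_eq_univ, mfderivWithin_univ] at this
  exact this

variable {F₂ : Type*} [NormedAddCommGroup F₂] [NormedSpace ℝ F₂]
  {H₂ : Type*} [TopologicalSpace H₂] {J₂ : ModelWithCorners ℝ F₂ H₂}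
  {X₂ : Type*} [TopologicalSpace X₂] [ChartedSpace H₂ X₂]
  {F₃ : Type*} [NormedAddCommGroup F₃] [NormedSpace ℝ F₃]
  {H₃ : Type*} [TopologicalSpace H₃] {J₃ : ModelWithCorners ℝ F₃ H₃}
  {X₃ : Type*} [TopologicalSpace X₃] [ChartedSpace H₃ X₃]

omit [IsManifold J₁ 1 X₁] [J₁.Boundaryless] in
/-- The chain rule, with derivatives read in the model spaces, so that no transport along the
equality `f x = y` is needed. -/
theorem hasMFDerivAt_comp_of_eq {f : X₁ → X₂} {g : X₂ → X₃} {x : X₁} {y : X₂}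
    {f' : F₁ →L[ℝ] F₂} {g' : F₂ →L[ℝ] F₃} (hg : HasMFDerivAt J₂ J₃ g y g')
    (hf : HasMFDerivAt J₁ J₂ f x f') (hy : f x = y) :
    HasMFDerivAt J₁ J₃ (fun x => g (f x)) x (g'.comp f') := by
  subst hy
  exact HasMFDerivAt.comp x hg hf

end Charts

section Action

variable {E : Type*} [NormedAddCommGroup E] [NormedSpace ℝ E]
  {M : Type*} [TopologicalSpace M] [ChartedSpace E M] [IsManifold 𝓘(ℝ, E) ∞ M]
  {E' : Type*} [NormedAddCommGroup E'] [NormedSpace ℝ E']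
  {G : Type*} [TopologicalSpace G] [ChartedSpace E' G] [Group G]
  [MulAction G M]

omit [IsManifold 𝓘(ℝ, E) ∞ M] [TopologicalSpace G] in
theorem cotangentLift_one (p : Cotangent E M) : cotangentLift (1 : G) p = p := by
  obtain ⟨u, α⟩ := p
  have h1 (σ : M → M) (hσ : σ = id) :
      (⟨σ u, α.comp (mfderiv 𝓘(ℝ, E) 𝓘(ℝ, E) σ u).inverse⟩ : Cotangent E M) = ⟨u, α⟩ := by
    subst hσ
    rw [mfderiv_id, ContinuousLinearMap.inverse_id]
    rfl
  exact h1 _ (funext fun u => one_smul G u)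

variable (E' G) in
/-- The action of `G` on `M` in the preferred charts at `1 : G` and at `u : M`. -/
def actionInChart (u : M) (z : E' × E) : E :=
  extChartAt 𝓘(ℝ, E) u
    ((extChartAt 𝓘(ℝ, E') (1 : G)).symm z.1 • (extChartAt 𝓘(ℝ, E) u).symm z.2)

omit [IsManifold 𝓘(ℝ, E) ∞ M] in
theorem eventually_actionInChart_one (u : M) :
    ∀ᶠ y in 𝓝 (extChartAt 𝓘(ℝ, E) u u),
      actionInChart E' G u (extChartAt 𝓘(ℝ, E') (1 : G) 1, y) = y := by
  filter_upwards [extChartAt_target_mem_nhds (I := 𝓘(ℝ, E)) u] with y hy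
  simp only [actionInChart, extChartAt_to_inv, one_smul, (extChartAt 𝓘(ℝ, E) u).right_inv hy]

variable [LieGroup 𝓘(ℝ, E') ∞ G] [ContMDiffSMul 𝓘(ℝ, E') 𝓘(ℝ, E) ∞ G M]

theorem contDiffAt_actionInChart {u : M} {s : E'} {y : E}
    (hs : s ∈ (extChartAt 𝓘(ℝ, E') (1 : G)).target) (hy : y ∈ (extChartAt 𝓘(ℝ, E) u).target)
    (h : (extChartAt 𝓘(ℝ, E') (1 : G)).symm s • (extChartAt 𝓘(ℝ, E) u).symm y ∈
      (extChartAt 𝓘(ℝ, E) u).source) :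
    ContDiffAt ℝ ∞ (actionInChart E' G u) (s, y) := by
  have h1 : ContMDiffAt 𝓘(ℝ, E' × E) 𝓘(ℝ, E') ∞
      (fun z : E' × E => (extChartAt 𝓘(ℝ, E') (1 : G)).symm z.1) (s, y) :=
    ((contMDiffOn_extChartAt_symm (1 : G)).contMDiffAt
      ((isOpen_extChartAt_target (1 : G)).mem_nhds hs)).comp (s, y)
      contDiffAt_fst.contMDiffAt
  have h2 : ContMDiffAt 𝓘(ℝ, E' × E) 𝓘(ℝ, E) ∞
      (fun z : E' × E => (extChartAt 𝓘(ℝ, E) u).symm z.2) (s, y) :=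
    ((contMDiffOn_extChartAt_symm u).contMDiffAt
      ((isOpen_extChartAt_target u).mem_nhds hy)).comp (s, y)
      contDiffAt_snd.contMDiffAt
  rw [extChartAt_source] at h
  exact ((contMDiffAt_extChartAt' h).comp (s, y) (h1.smul h2)).contDiffAt

theorem contDiffAt_actionInChart_one (u : M) :
    ContDiffAt ℝ ∞ (actionInChart E' G u)
      (extChartAt 𝓘(ℝ, E') (1 : G) 1, extChartAt 𝓘(ℝ, E) u u) :=
  contDiffAt_actionInChart (mem_extChartAt_target _) (mem_extChartAt_target _) (by simp)

omit [IsManifold 𝓘(ℝ, E) ∞ M] [LieGroup 𝓘(ℝ, E') ∞ G] in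
theorem hasMFDerivAt_smul_left (u : M) :
    HasMFDerivAt 𝓘(ℝ, E') 𝓘(ℝ, E) (fun g : G => g • u) 1 (generator E' G u) := by
  have h : ContMDiff 𝓘(ℝ, E') 𝓘(ℝ, E) ∞ (fun g : G => g • u) := contMDiff_id.smul contMDiff_const
  exact ((h 1).mdifferentiableAt (by simp)).hasMFDerivAt

omit [IsManifold 𝓘(ℝ, E) ∞ M] [LieGroup 𝓘(ℝ, E') ∞ G] in
include E' in
theorem mdifferentiableAt_smul (g : G) (u : M) :
    MDifferentiableAt 𝓘(ℝ, E) 𝓘(ℝ, E) (fun u : M => g • u) u := by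
  have h : ContMDiff 𝓘(ℝ, E) 𝓘(ℝ, E) ∞ (fun u : M => g • u) :=
    (contMDiff_const (I := 𝓘(ℝ, E)) (I' := 𝓘(ℝ, E')) (c := g)).smul contMDiff_id
  exact (h u).mdifferentiableAt (by simp)

/-- In the preferred charts the momentum map of the action is the momentum map of the local action:
the differentials of the charts of `M` at the base point of `q` cancel. -/
theorem momentumMap_eq_localMomentum {p q : Cotangent E M}
    (hq : q ∈ (extChartAt (cotangentModel E) p).source) :
    momentumMap E' G q = localMomentum (actionInChart E' G p.1) (extChartAt 𝓘(ℝ, E') (1 : G) 1)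
      (extChartAt (cotangentModel E) p q) := by
  have : IsManifold 𝓘(ℝ, E') 1 G := inferInstance
  have hq1 := mem_extChartAt_cotangent_source.1 hq
  rw [extChartAt_cotangent_apply hq1]
  set φ := extChartAt 𝓘(ℝ, E) p.1 with hφ
  set κ := extChartAt 𝓘(ℝ, E') (1 : G) with hκ
  have hψ : ContDiffAt ℝ ∞ (actionInChart E' G p.1) (κ 1, φ q.1) :=
    contDiffAt_actionInChart (mem_extChartAt_target _) (φ.map_source hq1)
      (by rw [extChartAt_to_inv, one_smul, φ.left_inv hq1]; exact hq1)
  have h1 : HasFDerivAt (fun s => actionInChart E' G p.1 (s, φ q.1))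
      ((fderiv ℝ (actionInChart E' G p.1) (κ 1, φ q.1)).comp (ContinuousLinearMap.inl ℝ E' E))
      (κ 1) :=
    HasFDerivAt.comp (g := actionInChart E' G p.1) (κ 1)
      (hψ.differentiableAt (by simp)).hasFDerivAt (hasFDerivAt_prodMk_left (κ 1) (φ q.1))
  have h2 : HasMFDerivAt 𝓘(ℝ, E') 𝓘(ℝ, E') κ.symm (κ 1) (ContinuousLinearMap.id ℝ E') := by
    rw [← mfderiv_extChartAt_symm_self]
    exact (mdifferentiableAt_extChartAt_symm (mem_extChartAt_target _)).hasMFDerivAt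
  have h3 : HasMFDerivAt 𝓘(ℝ, E) 𝓘(ℝ, E) φ q.1 (mfderiv 𝓘(ℝ, E) 𝓘(ℝ, E) φ q.1) := by
    refine (mdifferentiableAt_extChartAt ?_).hasMFDerivAt
    rwa [← extChartAt_source 𝓘(ℝ, E)]
  have h4 : HasMFDerivAt 𝓘(ℝ, E') 𝓘(ℝ, E) (fun s => actionInChart E' G p.1 (s, φ q.1)) (κ 1)
      ((mfderiv 𝓘(ℝ, E) 𝓘(ℝ, E) φ q.1).comp (generator E' G q.1)) := by
    have := hasMFDerivAt_comp_of_eq h3 (hasMFDerivAt_comp_of_eq (hasMFDerivAt_smul_left q.1) h2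
       (extChartAt_to_inv (I := 𝓘(ℝ, E')) (1 : G))) (by rw [extChartAt_to_inv, one_smul])
    have heq : (fun s => actionInChart E' G p.1 (s, φ q.1)) = fun s => φ (κ.symm s • q.1) := by
      funext s
      change φ (κ.symm s • φ.symm (φ q.1)) = _
      rw [φ.left_inv hq1]
    rw [heq]
    exact this
  have h5 := hasMFDerivAt_unique h1.hasMFDerivAt h4
  have h6 := mfderiv_extChartAt_symm_comp hq1
  refine ContinuousLinearMap.ext fun a => ?_
  have h7 := congrArg (fun T : E' →L[ℝ] E =>
    q.2 (mfderiv 𝓘(ℝ, E) 𝓘(ℝ, E) φ.symm (φ q.1) (T a))) h5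
  exact (h7.trans (congrArg (fun T => q.2 (T (generator E' G q.1 a))) h6)).symm

/-- `(α ∘ A⁻¹) ∘ C⁻¹ = α ∘ (C ∘ A)⁻¹`. The maps are between copies of the model space, so that it
applies to differentials whose source and target are tangent spaces at different points. -/
theorem comp_inverse_comp_of_inverse_eq {α : E →L[ℝ] ℝ} {A B C D : E →L[ℝ] E}
    (hC : C.IsInvertible) (hB : C.inverse = B) (hD : D = C.comp A) :
    (α.comp A.inverse).comp B = α.comp D.inverse := by
  rw [hD, hC.inverse_comp_of_left, hB, ContinuousLinearMap.comp_assoc]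

/-- In the preferred charts the orbit maps of the lifted action are those of the lift of the local
action: the differential of the chart of `M` at the end point of an orbit is invertible, so it can
be moved into the inverse in the definition of the lift. -/
theorem extChartAt_cotangentLift {p : Cotangent E M} {s : E'}
    (hs : s ∈ (extChartAt 𝓘(ℝ, E') (1 : G)).target)
    (h : (extChartAt 𝓘(ℝ, E') (1 : G)).symm s • p.1 ∈ (extChartAt 𝓘(ℝ, E) p.1).source) :
    extChartAt (cotangentModel E) p (cotangentLift ((extChartAt 𝓘(ℝ, E') (1 : G)).symm s) p) =
      localLift (actionInChart E' G p.1) (extChartAt (cotangentModel E) p p) s := by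
  set φ := extChartAt 𝓘(ℝ, E) p.1 with hφ
  set κ := extChartAt 𝓘(ℝ, E') (1 : G) with hκ
  rw [extChartAt_cotangent_self, extChartAt_cotangent_apply (q := cotangentLift _ p) h]
  have hψ : ContDiffAt ℝ ∞ (actionInChart E' G p.1) (s, φ p.1) :=
    contDiffAt_actionInChart hs (mem_extChartAt_target _) (by rwa [extChartAt_to_inv])
  have h1 : HasFDerivAt (fun y => actionInChart E' G p.1 (s, y))
      ((fderiv ℝ (actionInChart E' G p.1) (s, φ p.1)).comp (ContinuousLinearMap.inr ℝ E' E))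
      (φ p.1) :=
    (hψ.differentiableAt (by simp)).hasFDerivAt.comp (φ p.1) (hasFDerivAt_prodMk_right s (φ p.1))
  have h2 : HasMFDerivAt 𝓘(ℝ, E) 𝓘(ℝ, E) φ.symm (φ p.1) (ContinuousLinearMap.id ℝ E) := by
    rw [← mfderiv_extChartAt_symm_self]
    exact (mdifferentiableAt_extChartAt_symm (mem_extChartAt_target _)).hasMFDerivAt
  have h3 : HasMFDerivAt 𝓘(ℝ, E) 𝓘(ℝ, E) φ (κ.symm s • p.1)
      (mfderiv 𝓘(ℝ, E) 𝓘(ℝ, E) φ (κ.symm s • p.1)) := by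
    refine (mdifferentiableAt_extChartAt ?_).hasMFDerivAt
    rwa [← extChartAt_source 𝓘(ℝ, E)]
  have h4 : HasMFDerivAt 𝓘(ℝ, E) 𝓘(ℝ, E) (fun y => actionInChart E' G p.1 (s, y)) (φ p.1)
      ((mfderiv 𝓘(ℝ, E) 𝓘(ℝ, E) φ (κ.symm s • p.1)).comp
        (mfderiv 𝓘(ℝ, E) 𝓘(ℝ, E) (fun u : M => κ.symm s • u) p.1)) := by
    have := hasMFDerivAt_comp_of_eq h3 (hasMFDerivAt_comp_of_eq
      (mdifferentiableAt_smul (E' := E') (κ.symm s) p.1).hasMFDerivAt h2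
       (extChartAt_to_inv (I := 𝓘(ℝ, E)) p.1)) (by rw [extChartAt_to_inv])
    exact this
  have h5 := hasMFDerivAt_unique h1.hasMFDerivAt h4
  refine Prod.ext ?_ ?_
  · simp [localLift, actionInChart, cotangentLift, hκ]
  · have h6 : ContinuousLinearMap.IsInvertible (mfderiv 𝓘(ℝ, E) 𝓘(ℝ, E) φ (κ.symm s • p.1)) :=
      isInvertible_mfderiv_extChartAt h
    have h7 : ContinuousLinearMap.inverse (mfderiv 𝓘(ℝ, E) 𝓘(ℝ, E) φ (κ.symm s • p.1)) =
      mfderiv 𝓘(ℝ, E) 𝓘(ℝ, E) φ.symm (φ (κ.symm s • p.1)) :=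
      ContinuousLinearMap.inverse_eq (mfderiv_extChartAt_comp_symm h)
        (mfderiv_extChartAt_symm_comp h)
    exact comp_inverse_comp_of_inverse_eq (E := E) h6 h7 h5

theorem extChartAt_cotangent_self_fst (p : Cotangent E M) :
    (extChartAt (cotangentModel E) p p).1 = extChartAt 𝓘(ℝ, E) p.1 p.1 := by
  rw [extChartAt_cotangent_self]

theorem contDiffAt_actionInChart_cotangent (p : Cotangent E M) :
    ContDiffAt ℝ ∞ (actionInChart E' G p.1)
      (extChartAt 𝓘(ℝ, E') (1 : G) 1, (extChartAt (cotangentModel E) p p).1) := by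
  rw [extChartAt_cotangent_self_fst]
  exact contDiffAt_actionInChart_one p.1

omit [LieGroup 𝓘(ℝ, E') ∞ G] [ContMDiffSMul 𝓘(ℝ, E') 𝓘(ℝ, E) ∞ G M] in
theorem eventually_actionInChart_cotangent (p : Cotangent E M) :
    ∀ᶠ y in 𝓝 (extChartAt (cotangentModel E) p p).1,
      actionInChart E' G p.1 (extChartAt 𝓘(ℝ, E') (1 : G) 1, y) = y := by
  rw [extChartAt_cotangent_self_fst]
  exact eventually_actionInChart_one p.1

variable (E' G) in
/-- The momentum map in the preferred charts at `1 : G` and at `p : T*M`. -/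
def momentumInChart (p : Cotangent E M) : E × (E →L[ℝ] ℝ) → E' →L[ℝ] ℝ :=
  localMomentum (actionInChart E' G p.1) (extChartAt 𝓘(ℝ, E') (1 : G) 1)

variable (E' G) in
/-- The orbit map `g ↦ g • p` of the lifted action in the preferred charts at `1 : G` and at
`p : T*M`. -/
def orbitInChart (p : Cotangent E M) : E' → E × (E →L[ℝ] ℝ) :=
  localLift (actionInChart E' G p.1) (extChartAt (cotangentModel E) p p)

theorem contDiffAt_momentumInChart (p : Cotangent E M) :
    ContDiffAt ℝ ∞ (momentumInChart E' G p) (extChartAt (cotangentModel E) p p) :=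
  contDiffAt_localMomentum (contDiffAt_actionInChart_cotangent p)

theorem contDiffAt_orbitInChart [CompleteSpace E] (p : Cotangent E M) :
    ContDiffAt ℝ ∞ (orbitInChart E' G p) (extChartAt 𝓘(ℝ, E') (1 : G) 1) :=
  contDiffAt_localLift (contDiffAt_actionInChart_cotangent p) (eventually_actionInChart_cotangent p)

theorem momentumMap_extChartAt_symm {p : Cotangent E M} {z : E × (E →L[ℝ] ℝ)}
    (hz : z ∈ (extChartAt (cotangentModel E) p).target) :
    momentumMap E' G ((extChartAt (cotangentModel E) p).symm z) = momentumInChart E' G p z := by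
  rw [momentumMap_eq_localMomentum ((extChartAt (cotangentModel E) p).map_target hz),
    (extChartAt (cotangentModel E) p).right_inv hz]
  rfl

theorem hasMFDerivAt_momentumMap (p : Cotangent E M) :
    HasMFDerivAt (cotangentModel E) 𝓘(ℝ, E' →L[ℝ] ℝ)
      (fun q : Cotangent E M => momentumMap E' G q) p
      (fderiv ℝ (momentumInChart E' G p) (extChartAt (cotangentModel E) p p)) := by
  refine hasMFDerivAt_of_eventually_chart ?_
    ((contDiffAt_momentumInChart p).differentiableAt (by simp)).hasFDerivAt
  filter_upwards [extChartAt_source_mem_nhds (I := cotangentModel E) p] with q hq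
  exact ⟨by rw [extChartAt_model_space_eq_id]; trivial, momentumMap_eq_localMomentum hq⟩

theorem eventually_extChartAt_cotangentLift (p : Cotangent E M) :
    ∀ᶠ g in 𝓝 (1 : G), cotangentLift g p ∈ (extChartAt (cotangentModel E) p).source ∧
      extChartAt (cotangentModel E) p (cotangentLift g p) =
        orbitInChart E' G p (extChartAt 𝓘(ℝ, E') (1 : G) g) := by
  have hc : ContinuousAt (fun g : G => g • p.1) 1 :=
    (hasMFDerivAt_smul_left (E := E) (E' := E') p.1).continuousAt
  have hs : (extChartAt 𝓘(ℝ, E) p.1).source ∈ 𝓝 ((1 : G) • p.1) := by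
    rw [one_smul]; exact extChartAt_source_mem_nhds p.1
  filter_upwards [hc hs, extChartAt_source_mem_nhds (I := 𝓘(ℝ, E')) (1 : G)] with g hg hg'
  refine ⟨mem_extChartAt_cotangent_source.2 hg, ?_⟩
  have h1 := (extChartAt 𝓘(ℝ, E') (1 : G)).left_inv hg'
  have h2 := extChartAt_cotangentLift (p := p) ((extChartAt 𝓘(ℝ, E') (1 : G)).map_source hg')
    (by rw [h1]; exact hg)
  rwa [h1] at h2

theorem hasMFDerivAt_cotangentLift [CompleteSpace E] (p : Cotangent E M) :
    HasMFDerivAt 𝓘(ℝ, E') (cotangentModel E) (fun g : G => cotangentLift g p) 1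
      (fderiv ℝ (orbitInChart E' G p) (extChartAt 𝓘(ℝ, E') (1 : G) 1)) := by
  refine hasMFDerivAt_of_eventually_chart ?_
    ((contDiffAt_orbitInChart p).differentiableAt (by simp)).hasFDerivAt
  rw [cotangentLift_one]
  exact eventually_extChartAt_cotangentLift p

theorem liftedGenerator_eq [CompleteSpace E] (p : Cotangent E M) :
    liftedGenerator E' G p =
      fderiv ℝ (orbitInChart E' G p) (extChartAt 𝓘(ℝ, E') (1 : G) 1) :=
  (hasMFDerivAt_cotangentLift p).mfderiv

/-- The defining property of the momentum map: `i_{K_a} ω = -d⟨l, a⟩`. -/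
theorem symplecticForm_liftedGenerator [CompleteSpace E] (p : Cotangent E M) (a : E')
    (w : E × (E →L[ℝ] ℝ)) :
    symplecticForm p (liftedGenerator E' G p a) w =
      - fderiv ℝ (momentumInChart E' G p) (extChartAt (cotangentModel E) p p) w a := by
  rw [liftedGenerator_eq]
  exact (symplecticForm_apply p _ w).trans (standardSymplectic_fderiv_localLift
    (contDiffAt_actionInChart_cotangent p) (eventually_actionInChart_cotangent p) a w)

end Action

/-! ### Equivariance of the momentum map -/

section Adjoint

variable {E : Type*} [NormedAddCommGroup E] [NormedSpace ℝ E]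
  {M : Type*} [TopologicalSpace M] [ChartedSpace E M] [IsManifold 𝓘(ℝ, E) ∞ M]
  {E' : Type*} [NormedAddCommGroup E'] [NormedSpace ℝ E']
  {G : Type*} [TopologicalSpace G] [ChartedSpace E' G] [Group G] [LieGroup 𝓘(ℝ, E') ∞ G]

theorem hasMFDerivAt_conj (g : G) :
    HasMFDerivAt 𝓘(ℝ, E') 𝓘(ℝ, E') (fun h : G => g * h * g⁻¹) 1 (Ad (E' := E') g) := by
  have h : ContMDiff 𝓘(ℝ, E') 𝓘(ℝ, E') ∞ (fun h : G => g * h * g⁻¹) :=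
    (contMDiff_const.mul contMDiff_id).mul contMDiff_const
  exact ((h 1).mdifferentiableAt (by simp)).hasMFDerivAt

theorem Ad_mul (g h : G) : Ad (E' := E') (g * h) = (Ad g).comp (Ad (E' := E') h) := by
  have h1 := hasMFDerivAt_comp_of_eq (hasMFDerivAt_conj (E' := E') g)
    (hasMFDerivAt_conj (E' := E') h) (by simp)
  have h2 : (fun x : G => g * (h * x * h⁻¹) * g⁻¹) = fun x => (g * h) * x * (g * h)⁻¹ := by
    funext x; group
  rw [h2] at h1
  exact h1.mfderiv

variable [MulAction G M] [ContMDiffSMul 𝓘(ℝ, E') 𝓘(ℝ, E) ∞ G M]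

omit [IsManifold 𝓘(ℝ, E) ∞ M] [LieGroup 𝓘(ℝ, E') ∞ G] in
include E' in
theorem isInvertible_mfderiv_smul (g : G) (u : M) :
    ContinuousLinearMap.IsInvertible
      (mfderiv 𝓘(ℝ, E) 𝓘(ℝ, E) (fun u : M => g • u) u : E →L[ℝ] E) := by
  have h (k : G) (w : M) := (mdifferentiableAt_smul (E := E) (E' := E') k w).hasMFDerivAt
  have h1 := hasMFDerivAt_comp_of_eq (h g⁻¹ (g • u)) (h g u) rfl
  have h2 := hasMFDerivAt_comp_of_eq (h g u) (h g⁻¹ (g • u)) (inv_smul_smul g u)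
  rw [show (fun x : M => g⁻¹ • g • x) = id from funext (inv_smul_smul g)] at h1
  rw [show (fun x : M => g • g⁻¹ • x) = id from funext (smul_inv_smul g)] at h2
  exact ContinuousLinearMap.IsInvertible.of_inverse (hasMFDerivAt_unique h2 (hasMFDerivAt_id _))
    (hasMFDerivAt_unique h1 (hasMFDerivAt_id _))

omit [IsManifold 𝓘(ℝ, E) ∞ M] in
/-- As `h • g • u = g • (g⁻¹hg) • u`, the generators satisfy
`k_a(gu) = d_u g (k_(Ad_(g⁻¹)a)(u))`. -/
theorem generator_smul (g : G) (u : M) :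
    generator E' G (g • u) = ContinuousLinearMap.comp
      (mfderiv 𝓘(ℝ, E) 𝓘(ℝ, E) (fun u : M => g • u) u : E →L[ℝ] E)
      ((generator E' G u).comp (Ad g⁻¹) : E' →L[ℝ] E) := by
  have h1 := hasMFDerivAt_comp_of_eq (mdifferentiableAt_smul (E := E) (E' := E') g u).hasMFDerivAt
    (hasMFDerivAt_comp_of_eq (hasMFDerivAt_smul_left (E := E) (E' := E') u)
      (hasMFDerivAt_conj (E' := E') g⁻¹) (by simp)) (by simp)
  have h2 : (fun h : G => g • (g⁻¹ * h * g⁻¹⁻¹) • u) = fun h => h • g • u := by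
    funext h; simp [smul_smul, mul_assoc]
  rw [h2] at h1
  exact h1.mfderiv

/-- The factor `T` of `k' = T ∘ k ∘ A` cancels against the `T⁻¹` of a lifted covector. -/
theorem comp_inverse_comp_comp {α : E →L[ℝ] ℝ} {T : E →L[ℝ] E} {k k' : E' →L[ℝ] E}
    {A : E' →L[ℝ] E'} (hT : T.IsInvertible) (hk : k' = T.comp (k.comp A)) :
    (α.comp T.inverse).comp k' = (α.comp k).comp A := by
  obtain ⟨e, rfl⟩ := hT
  ext a
  simp [hk]

omit [IsManifold 𝓘(ℝ, E) ∞ M] in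
/-- The momentum map is equivariant for the coadjoint action. -/
theorem momentumMap_cotangentLift (g : G) (q : Cotangent E M) :
    momentumMap E' G (cotangentLift g q) = (momentumMap E' G q).comp (Ad (E' := E') g⁻¹) := by
  exact comp_inverse_comp_comp (E := E) (E' := E')
    (isInvertible_mfderiv_smul (E := E) (E' := E') g q.1) (generator_smul (E := E) (E' := E') g q.1)

omit [LieGroup 𝓘(ℝ, E') ∞ G] in
theorem mem_coadjointStabilizer_iff {ξ : E' →L[ℝ] ℝ} {g : G} :
    g ∈ coadjointStabilizer ξ ↔ ξ.comp (Ad (E' := E') g⁻¹) = ξ :=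
  ⟨fun h => ContinuousLinearMap.ext h, fun h a => DFunLike.congr_fun h a⟩

omit [IsManifold 𝓘(ℝ, E) ∞ M] in
/-- By equivariance, `g` stabilizes `ξ` exactly if it maps a given point of the level set of `ξ` to
the level set. -/
theorem mem_coadjointStabilizer_iff_cotangentLift_mem {ξ : E' →L[ℝ] ℝ} {g : G} {p : Cotangent E M}
    (hp : p ∈ levelSet G ξ) :
    g ∈ coadjointStabilizer ξ ↔ momentumMap E' G (cotangentLift g p) = ξ := by
  have h := momentumMap_cotangentLift (E' := E') g p
  rw [show momentumMap E' G p = ξ from hp] at h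
  rw [h]
  exact mem_coadjointStabilizer_iff

end Adjoint

/-! ### Tangent vectors as velocities of curves -/

section TangentVectors

variable {F : Type*} [NormedAddCommGroup F] [NormedSpace ℝ F]
  {H : Type*} [TopologicalSpace H] {J : ModelWithCorners ℝ F H}
  {X : Type*} [TopologicalSpace X] [ChartedSpace H X]

/-- The velocity of a curve in `S` determines its derivative, as a map from `ℝ` to the model
space. -/
theorem exists_curve_of_mem_tangentVectors {S : Set X} {x : X} {v : F}
    (hv : v ∈ tangentVectors J S x) :
    ∃ γ : ℝ → X, γ 0 = x ∧ (∀ᶠ t in 𝓝 (0 : ℝ), γ t ∈ S) ∧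
      HasMFDerivAt 𝓘(ℝ, ℝ) J γ 0 (ContinuousLinearMap.toSpanSingleton ℝ v) := by
  obtain ⟨γ, hγ, hS, h⟩ := hv
  have h1 := hγ.mdifferentiableAt one_ne_zero
  obtain ⟨rfl, h2⟩ := TotalSpace.mk.inj h
  refine ⟨γ, rfl, hS, ?_⟩
  have h3 := h1.hasMFDerivAt
  have key (T : ℝ →L[ℝ] F) : T = ContinuousLinearMap.toSpanSingleton ℝ (T 1) :=
    ContinuousLinearMap.ext_ring (by simp)
  have h4 : mfderiv 𝓘(ℝ, ℝ) J γ 0 = ContinuousLinearMap.toSpanSingleton ℝ v :=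
    (key _).trans (congrArg _ (eq_of_heq h2))
  rwa [h4] at h3

/-- The velocity of a curve `c` in the preferred chart is tangent to `S` if the curve of `X` that
`c` represents lies in `S`. -/
theorem mem_tangentVectors_of_chart [IsManifold J 1 X] [J.Boundaryless] {S : Set X} {x : X} {v : F}
    {c : ℝ → F} (hc : ContDiffAt ℝ 1 c 0) (h0 : c 0 = extChartAt J x x) (hv : HasDerivAt c v 0)
    (hS : ∀ᶠ t in 𝓝 (0 : ℝ), (extChartAt J x).symm (c t) ∈ S) :
    v ∈ tangentVectors J S x := by
  have h1 : HasMFDerivAt 𝓘(ℝ, F) J (extChartAt J x).symm (extChartAt J x x)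
      (ContinuousLinearMap.id ℝ F) := by
    rw [← mfderiv_extChartAt_symm_self]
    exact (mdifferentiableAt_extChartAt_symm (mem_extChartAt_target x)).hasMFDerivAt
  have h2 := hasMFDerivAt_comp_of_eq h1 hv.hasFDerivAt.hasMFDerivAt h0
  have h3 : (extChartAt J x).symm (c 0) = x := by rw [h0, extChartAt_to_inv]
  have h4 : ContMDiffAt 𝓘(ℝ, F) J 1 (extChartAt J x).symm (c 0) := by
    rw [h0]
    exact (contMDiffOn_extChartAt_symm x).contMDiffAt (extChartAt_target_mem_nhds x)
  refine ⟨fun t => (extChartAt J x).symm (c t), h4.comp 0 hc.contMDiffAt, hS, ?_⟩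
  have key (γ : ℝ → X) (f' : ℝ →L[ℝ] F) (hγ : HasMFDerivAt 𝓘(ℝ, ℝ) J γ 0 f') (hx : γ 0 = x)
      (hf : f' 1 = v) :
      (⟨γ 0, mfderiv 𝓘(ℝ, ℝ) J γ 0 (1 : ℝ)⟩ : TangentBundle J X) = ⟨x, v⟩ := by
    subst hx hf
    rw [hγ.mfderiv]
    rfl
  exact key _ _ h2 h3 (one_smul ℝ v)

end TangentVectors

/-! ### Curves in level sets -/

section Curves

variable {F : Type*} [NormedAddCommGroup F] [NormedSpace ℝ F]
  {V : Type*} [NormedAddCommGroup V] [NormedSpace ℝ V]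

/-- Every vector in the kernel of a surjective derivative is the velocity of a `C¹` curve in the
level set. With `R` a right inverse of the derivative `L`, the map
`h(x) = R(l(x) - l(x₀)) + (x - x₀) - RL(x - x₀)` has derivative the identity at `x₀`, and the curve
is `t ↦ h⁻¹(tv)`. -/
theorem exists_curve_levelSet [CompleteSpace F] [FiniteDimensional ℝ V] {l : F → V} {x₀ v : F}
    (hl : ContDiffAt ℝ 1 l x₀) (hsurj : Function.Surjective (fderiv ℝ l x₀))
    (hv : fderiv ℝ l x₀ v = 0) :
    ∃ c : ℝ → F, ContDiffAt ℝ 1 c 0 ∧ c 0 = x₀ ∧ HasDerivAt c v 0 ∧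
      ∀ᶠ t in 𝓝 (0 : ℝ), l (c t) = l x₀ := by
  obtain ⟨R, hR⟩ := (fderiv ℝ l x₀).exists_rightInverse_of_surjective
    (LinearMap.range_eq_top.2 hsurj)
  have hR' (y : V) : fderiv ℝ l x₀ (R y) = y := DFunLike.congr_fun hR y
  set L := fderiv ℝ l x₀ with hL
  let h : F → F := fun x => R (l x - l x₀) + ((x - x₀) - R (L (x - x₀)))
  have hh : ContDiffAt ℝ 1 h x₀ := by
    have h1 : ContDiffAt ℝ 1 (fun x => x - x₀) x₀ := contDiffAt_id.sub contDiffAt_const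
    exact (R.contDiff.contDiffAt.comp x₀ (hl.sub contDiffAt_const)).add
      (h1.sub (R.contDiff.contDiffAt.comp x₀ (L.contDiff.contDiffAt.comp x₀ h1)))
  have hd : HasFDerivAt h ((ContinuousLinearEquiv.refl ℝ F : F ≃L[ℝ] F) : F →L[ℝ] F) x₀ := by
    have h1 : HasFDerivAt (fun x => x - x₀) (ContinuousLinearMap.id ℝ F) x₀ :=
      (hasFDerivAt_id x₀).sub_const x₀
    have h2 := (hl.differentiableAt one_ne_zero).hasFDerivAt
    have h3 := (R.hasFDerivAt.comp x₀ (h2.sub_const (l x₀))).add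
      (h1.sub (R.hasFDerivAt.comp x₀ (L.hasFDerivAt.comp x₀ h1)))
    refine h3.congr_fderiv ?_
    ext w
    simp [hL]
  have hx : h x₀ = 0 := by simp [h]
  set k := hh.localInverse hd one_ne_zero with hk
  have hk1 : ContDiffAt ℝ 1 k 0 := by
    have := hh.to_localInverse hd one_ne_zero
    rwa [hx] at this
  have hk0 : k 0 = x₀ := by
    have := hh.localInverse_apply_image hd one_ne_zero
    rwa [hx] at this
  have hkd : HasFDerivAt k (ContinuousLinearMap.id ℝ F) 0 := by
    have := ((hh.hasStrictFDerivAt' hd one_ne_zero).to_localInverse).hasFDerivAt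
    rw [hx] at this
    exact this
  have hkr : ∀ᶠ y in 𝓝 (0 : F), h (k y) = y := by
    have := (hh.hasStrictFDerivAt' hd one_ne_zero).eventually_right_inverse
    rw [hx] at this
    exact this
  have hline : HasDerivAt (fun t : ℝ => t • v) v 0 := by
    simpa using (hasDerivAt_id (0 : ℝ)).smul_const v
  have hlt : Tendsto (fun t : ℝ => t • v) (𝓝 0) (𝓝 0) := by
    simpa using hline.continuousAt.tendsto
  refine ⟨fun t => k (t • v), ?_, by simp [hk0], ?_, ?_⟩
  · refine ContDiffAt.comp (g := k) 0 ?_ (contDiffAt_id.smul contDiffAt_const)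
    simpa using hk1
  · have h1 : HasFDerivAt k (ContinuousLinearMap.id ℝ F) ((0 : ℝ) • v) := by simpa using hkd
    exact h1.comp_hasDerivAt 0 hline
  · filter_upwards [hlt.eventually hkr] with t ht
    -- as `L ∘ R = id`, applying `L` to `h(c(t)) = tv` gives `l(c(t)) - l(x₀) = t L v = 0`
    have := congrArg L ht
    simp only [h, map_add, map_sub, map_smul, hR', hv, smul_zero] at this
    have h5 : l (k (t • v)) - l x₀ = 0 := by rw [← this]; abel
    exact sub_eq_zero.1 h5

/-- A function whose derivative vanishes on a `C¹` vector field is constant along the integral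
curve of the vector field. -/
theorem exists_curve_of_fderiv_vectorField_eq_zero [CompleteSpace F] {l : F → V} {W : F → F}
    {x₀ : F} (hW : ContDiffAt ℝ 1 W x₀)
    (hl : ∀ᶠ x in 𝓝 x₀, DifferentiableAt ℝ l x ∧ fderiv ℝ l x (W x) = 0) :
    ∃ c : ℝ → F, ContDiffAt ℝ 1 c 0 ∧ c 0 = x₀ ∧ HasDerivAt c (W x₀) 0 ∧
      ∀ᶠ t in 𝓝 (0 : ℝ), l (c t) = l x₀ := by
  obtain ⟨c, hc0, ε, hε, hc⟩ :=
    hW.exists_forall_mem_closedBall_exists_eq_forall_mem_Ioo_hasDerivAt₀ 0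
  have h0 : (0 : ℝ) ∈ Ioo (0 - ε) (0 + ε) := by constructor <;> linarith
  have hcd := hc 0 h0
  rw [hc0] at hcd
  have hct : Tendsto c (𝓝 0) (𝓝 x₀) := by simpa [hc0] using hcd.continuousAt.tendsto
  have hW' : ∀ᶠ x in 𝓝 x₀, ContDiffAt ℝ 1 W x := hW.eventually (by simp)
  have hI : ∀ᶠ t in 𝓝 (0 : ℝ), t ∈ Ioo (0 - ε) (0 + ε) := isOpen_Ioo.mem_nhds h0
  obtain ⟨δ, hδ, hball⟩ := Metric.eventually_nhds_iff_ball.1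
    (hI.and ((hct.eventually hl).and (hct.eventually hW')))
  refine ⟨c, ?_, hc0, hcd, ?_⟩
  · rw [contDiffAt_one_iff]
    refine ⟨fun t => ContinuousLinearMap.toSpanSingleton ℝ (W (c t)), Metric.ball 0 δ,
      Metric.ball_mem_nhds 0 hδ, fun t ht => ContinuousAt.continuousWithinAt ?_,
      fun t ht => (hc t (hball t ht).1).hasFDerivAt⟩
    have h1 : ContinuousAt (fun t => W (c t)) t :=
      (hball t ht).2.2.continuousAt.comp (hc t (hball t ht).1).continuousAt
    exact (ContinuousLinearMap.toSpanSingletonCLE (𝕜 := ℝ) (E := F)).continuous.continuousAt.comp h1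
  · have hd (t : ℝ) (ht : t ∈ Metric.ball 0 δ) : HasDerivAt (fun t => l (c t)) 0 t := by
      have := (hball t ht).2.1.1.hasFDerivAt.comp_hasDerivAt t (hc t (hball t ht).1)
      rwa [(hball t ht).2.1.2] at this
    filter_upwards [Metric.ball_mem_nhds (0 : ℝ) hδ] with t ht
    have := Metric.isOpen_ball.is_const_of_deriv_eq_zero (convex_ball (0 : ℝ) δ).isPreconnected
      (fun t ht => (hd t ht).differentiableAt.differentiableWithinAt)
      (fun t ht => (hd t ht).deriv) ht (Metric.mem_ball_self hδ)
    simpa [hc0] using this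

end Curves

/-! ### Tangent vectors of the level set and of the stabilizer -/

section Tangent

variable {E : Type*} [NormedAddCommGroup E] [NormedSpace ℝ E] [FiniteDimensional ℝ E]
  {M : Type*} [TopologicalSpace M] [ChartedSpace E M] [IsManifold 𝓘(ℝ, E) ∞ M]
  {E' : Type*} [NormedAddCommGroup E'] [NormedSpace ℝ E'] [FiniteDimensional ℝ E']
  {G : Type*} [TopologicalSpace G] [ChartedSpace E' G] [Group G] [LieGroup 𝓘(ℝ, E') ∞ G]
  [MulAction G M] [ContMDiffSMul 𝓘(ℝ, E') 𝓘(ℝ, E) ∞ G M]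

variable (E' G) in
/-- The differential of the momentum map at `p`, in the identification of `T_p(T*M)` with
`E × E*` by the preferred chart at `p`. -/
def momentumDeriv (p : Cotangent E M) : E × (E →L[ℝ] ℝ) →L[ℝ] (E' →L[ℝ] ℝ) :=
  fderiv ℝ (momentumInChart E' G p) (extChartAt (cotangentModel E) p p)

variable (E' G) in
/-- The map `a ↦ K_a(p)`, in the identification of `T_p(T*M)` with `E × E*` by the preferred chart
at `p`. -/
def orbitDeriv (p : Cotangent E M) : E' →L[ℝ] E × (E →L[ℝ] ℝ) :=
  fderiv ℝ (orbitInChart E' G p) (extChartAt 𝓘(ℝ, E') (1 : G) 1)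

/-- The derivative `A ∘ (t ↦ tw)` of a curve that is constant near `0` vanishes. -/
theorem apply_eq_zero_of_hasMFDerivAt_of_eventually_eq {V W : Type*} [NormedAddCommGroup V]
    [NormedSpace ℝ V] [NormedAddCommGroup W] [NormedSpace ℝ W] {k : ℝ → V} {A : W →L[ℝ] V} {w : W}
    {c : V}
    (hk : HasMFDerivAt 𝓘(ℝ, ℝ) 𝓘(ℝ, V) k 0 (A.comp (ContinuousLinearMap.toSpanSingleton ℝ w)))
    (hc : ∀ᶠ t in 𝓝 (0 : ℝ), k t = c) : A w = 0 := by
  have h0 : HasFDerivAt k (A.comp (ContinuousLinearMap.toSpanSingleton ℝ w)) 0 := hk.hasFDerivAt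
  have h1 := h0.unique ((hasFDerivAt_const c (0 : ℝ)).congr_of_eventuallyEq hc)
  simpa using DFunLike.congr_fun h1 1

/-- The tangent space of a regular level set of the momentum map is the kernel of its
differential. -/
theorem tangentVectors_levelSet {ξ : E' →L[ℝ] ℝ} {p : Cotangent E M} (hp : p ∈ levelSet G ξ)
    (hsurj : Function.Surjective (momentumDeriv E' G p)) (v : E × (E →L[ℝ] ℝ)) :
    v ∈ tangentVectors (cotangentModel E) (levelSet G ξ) p ↔ momentumDeriv E' G p v = 0 := by
  constructor
  · intro hv
    obtain ⟨γ, h0, hS, hγ⟩ := exists_curve_of_mem_tangentVectors hv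
    have h1 := hasMFDerivAt_comp_of_eq (hasMFDerivAt_momentumMap (E' := E') (G := G) p) hγ h0
    exact apply_eq_zero_of_hasMFDerivAt_of_eventually_eq h1 hS
  · intro hv
    obtain ⟨c, hc, h0, hcv, hl⟩ := exists_curve_levelSet
      ((contDiffAt_momentumInChart (E' := E') (G := G) p).of_le (by simp)) hsurj hv
    refine mem_tangentVectors_of_chart hc h0 hcv ?_
    have ht : ∀ᶠ t in 𝓝 (0 : ℝ), c t ∈ (extChartAt (cotangentModel E) p).target := by
      refine hc.continuousAt.eventually ?_
      rw [h0]
      exact extChartAt_target_mem_nhds p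
    filter_upwards [hl, ht] with t h1 h2
    have h3 := momentumMap_extChartAt_symm (E' := E') (G := G) (mem_extChartAt_target
      (I := cotangentModel E) p)
    rw [extChartAt_to_inv] at h3
    change momentumMap E' G _ = ξ
    rw [momentumMap_extChartAt_symm h2, h1, ← h3]
    exact hp

omit [FiniteDimensional ℝ E'] in
theorem tangentVectors_univ (a : E') : a ∈ tangentVectors 𝓘(ℝ, E') (univ : Set G) 1 := by
  have h : HasDerivAt (fun t : ℝ => extChartAt 𝓘(ℝ, E') (1 : G) 1 + t • a) a 0 := by
    simpa using ((hasDerivAt_id (0 : ℝ)).smul_const a).const_add (extChartAt 𝓘(ℝ, E') (1 : G) 1)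
  exact mem_tangentVectors_of_chart
    (contDiffAt_const.add (contDiffAt_id.smul contDiffAt_const)) (by simp) h (by simp)

omit [FiniteDimensional ℝ E'] in
/-- The derivative of `g ↦ l(g • p)` at the identity. -/
theorem hasMFDerivAt_momentumMap_cotangentLift (p : Cotangent E M) :
    HasMFDerivAt 𝓘(ℝ, E') 𝓘(ℝ, E' →L[ℝ] ℝ)
      (fun g : G => momentumMap E' G (cotangentLift g p)) 1
      ((momentumDeriv E' G p).comp (orbitDeriv E' G p)) := by
  have : CompleteSpace E := FiniteDimensional.complete ℝ E
  exact hasMFDerivAt_comp_of_eq (hasMFDerivAt_momentumMap p) (hasMFDerivAt_cotangentLift p)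
    (cotangentLift_one p)

variable (E' G) in
/-- The vector field on the chart at `1 : G` that represents the left-invariant vector field with
value `a` at `1`. -/
def leftInvariantInChart (a : E') (s : E') : E' :=
  fderiv ℝ (actionInChart E' G (1 : G)) (s, extChartAt 𝓘(ℝ, E') (1 : G) 1) (0, a)

/-- A vector `a` is tangent at `1` to the stabilizer of `ξ = l(p)` exactly if it is in the kernel of
the derivative of `g ↦ l(g • p) = ξ ∘ Ad_(g⁻¹)`. For such an `a`, this function is constant along
the integral curve through `1` of the left-invariant vector field of `a`, as
`ξ ∘ Ad_((gh)⁻¹) = (ξ ∘ Ad_(h⁻¹)) ∘ Ad_(g⁻¹)`. -/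
theorem tangentVectors_coadjointStabilizer {ξ : E' →L[ℝ] ℝ} {p : Cotangent E M}
    (hp : p ∈ levelSet G ξ) (a : E') :
    a ∈ tangentVectors 𝓘(ℝ, E') (coadjointStabilizer ξ : Set G) 1 ↔
      momentumDeriv E' G p (orbitDeriv E' G p a) = 0 := by
  have : CompleteSpace E := FiniteDimensional.complete ℝ E
  have : CompleteSpace E' := FiniteDimensional.complete ℝ E'
  constructor
  · intro ha
    obtain ⟨γ, h0, hS, hγ⟩ := exists_curve_of_mem_tangentVectors ha
    have h1 := hasMFDerivAt_comp_of_eq (hasMFDerivAt_momentumMap_cotangentLift p) hγ h0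
    have h2 : ∀ᶠ t in 𝓝 (0 : ℝ), momentumMap E' G (cotangentLift (γ t) p) = ξ := by
      filter_upwards [hS] with t ht
      exact (mem_coadjointStabilizer_iff_cotangentLift_mem hp).1 ht
    exact apply_eq_zero_of_hasMFDerivAt_of_eventually_eq
      (A := (momentumDeriv E' G p).comp (orbitDeriv E' G p)) h1 h2
  · intro ha
    set κ := extChartAt 𝓘(ℝ, E') (1 : G) with hκ
    set m : E' × E' → E' := actionInChart (E := E') E' G (1 : G) with hm
    set Φ : E' → E' →L[ℝ] ℝ := fun s => momentumMap E' G (cotangentLift (κ.symm s) p) with hΦ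
    have hm0 : ContDiffAt ℝ ∞ m (κ 1, κ 1) := contDiffAt_actionInChart_one (1 : G)
    have hW0 : leftInvariantInChart E' G a (κ 1) = a := by
      have := fderiv_comp_inr_eq_id (ψ := m) (s₀ := κ 1) (z₀ := (κ 1, 0))
        (hm0.differentiableAt (by simp)) (eventually_actionInChart_one (1 : G))
      change fderiv ℝ m (κ 1, κ 1) (0, a) = a
      simpa using DFunLike.congr_fun this a
    have hW : ContDiffAt ℝ 1 (leftInvariantInChart E' G a) (κ 1) := by
      have h1 : ContDiffAt ℝ 1 (fderiv ℝ m) (κ 1, κ 1) :=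
        (hm0.fderiv_right (m := ∞) (by simp)).of_le (by simp)
      have h2 : ContDiffAt ℝ 1 (fun s => fderiv ℝ m (s, κ 1)) (κ 1) :=
        ContDiffAt.comp (κ 1) h1 (contDiffAt_id.prodMk contDiffAt_const)
      exact h2.clm_apply contDiffAt_const
    have hκt : Tendsto κ.symm (𝓝 (κ 1)) (𝓝 1) := by
      have := continuousAt_extChartAt_symm (I := 𝓘(ℝ, E')) (1 : G)
      rwa [ContinuousAt, extChartAt_to_inv] at this
    have hκs : ∀ᶠ s in 𝓝 (κ 1), s ∈ κ.target := extChartAt_target_mem_nhds (1 : G)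
    have hΦ1 : ContDiffAt ℝ 1 Φ (κ 1) := by
      have h1 := (eventually_extChartAt_cotangentLift (E' := E') (G := G) p).self_of_nhds.2
      rw [cotangentLift_one] at h1
      have h2 : ContDiffAt ℝ ∞ (momentumInChart E' G p) (orbitInChart E' G p (κ 1)) := by
        rw [← h1]
        exact contDiffAt_momentumInChart p
      refine ((h2.comp (κ 1) (contDiffAt_orbitInChart p)).of_le (by simp)).congr_of_eventuallyEq ?_
      filter_upwards [hκt.eventually
        (eventually_extChartAt_cotangentLift (E' := E') p), hκs] with s hs hs'
      rw [hκ] at hs hs'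
      rw [(extChartAt 𝓘(ℝ, E') (1 : G)).right_inv hs'] at hs
      rw [Function.comp_apply, ← hs.2]
      exact momentumMap_eq_localMomentum hs.1
    have hΦ0 : fderiv ℝ Φ (κ 1) a = 0 := by
      have h1 : HasMFDerivAt 𝓘(ℝ, E') 𝓘(ℝ, E') κ.symm (κ 1) (ContinuousLinearMap.id ℝ E') := by
        rw [← mfderiv_extChartAt_symm_self (J₁ := 𝓘(ℝ, E')) (1 : G)]
        exact (mdifferentiableAt_extChartAt_symm (mem_extChartAt_target _)).hasMFDerivAt
      have h2 : HasFDerivAt Φ (((momentumDeriv E' G p).comp (orbitDeriv E' G p)).comp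
          (ContinuousLinearMap.id ℝ E')) (κ 1) :=
        (hasMFDerivAt_comp_of_eq (hasMFDerivAt_momentumMap_cotangentLift p) h1
          (extChartAt_to_inv (I := 𝓘(ℝ, E')) (1 : G))).hasFDerivAt
      rw [h2.fderiv]
      simpa using ha
    -- with `m` the multiplication in the chart, `Φ(m(s, r)) = Φ(r) ∘ Ad_(s⁻¹)`; differentiated in `r`
    -- at the identity, this expresses the derivative of `Φ` on the left-invariant field at `s`
    -- through its derivative at the identity
    have hl : ∀ᶠ s in 𝓝 (κ 1), DifferentiableAt ℝ Φ s ∧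
        fderiv ℝ Φ s (leftInvariantInChart E' G a s) = 0 := by
      have hpair : Tendsto (fun s => (s, κ 1)) (𝓝 (κ 1)) (𝓝 (κ 1, κ 1)) :=
        (continuousAt_id.prodMk continuousAt_const)
      filter_upwards [hκs, (hΦ1.eventually (by simp)),
        hpair.eventually ((hm0.of_le (m := 1) (by simp)).eventually (by simp))] with s hs hΦs hms
      have hΦd := hΦs.differentiableAt one_ne_zero
      refine ⟨hΦd, ?_⟩
      have hgs : κ.symm s ∈ κ.source := κ.map_target hs
      have hms0 : m (s, κ 1) = s := by
        change κ (κ.symm s * κ.symm (κ 1)) = s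
        rw [extChartAt_to_inv, mul_one, κ.right_inv hs]
      have hmul : ∀ᶠ s' in 𝓝 (κ 1), κ.symm s * κ.symm s' ∈ κ.source := by
        have : Tendsto (fun s' => κ.symm s * κ.symm s') (𝓝 (κ 1)) (𝓝 (κ.symm s)) := by
          have h1 : Continuous fun h : G => κ.symm s * h :=
            (contMDiff_mul_left (I := 𝓘(ℝ, E')) (n := ∞)).continuous
          have h2 := h1.tendsto 1
          rw [mul_one] at h2
          exact h2.comp hκt
        exact this.eventually ((isOpen_extChartAt_source (1 : G)).mem_nhds hgs)
      have hequiv : ∀ᶠ s' in 𝓝 (κ 1),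
          Φ (m (s, s')) = (Φ s').comp (Ad (E' := E') (κ.symm s)⁻¹) := by
        filter_upwards [hmul] with s' hs'
        have h1 : κ.symm (m (s, s')) = κ.symm s * κ.symm s' := κ.left_inv hs'
        simp only [hΦ, h1]
        rw [momentumMap_cotangentLift, momentumMap_cotangentLift, mul_inv_rev, Ad_mul]
        rfl
      have hd1 : HasFDerivAt (fun s' => Φ (m (s, s')))
          ((fderiv ℝ Φ s).comp ((fderiv ℝ m (s, κ 1)).comp (ContinuousLinearMap.inr ℝ E' E')))
          (κ 1) := by
        have h1 : HasFDerivAt (fun s' => m (s, s'))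
            ((fderiv ℝ m (s, κ 1)).comp (ContinuousLinearMap.inr ℝ E' E')) (κ 1) :=
          HasFDerivAt.comp (g := m) (κ 1) (hms.differentiableAt one_ne_zero).hasFDerivAt
            (hasFDerivAt_prodMk_right s (κ 1))
        have h2 : HasFDerivAt Φ (fderiv ℝ Φ s) (m (s, κ 1)) := by
          rw [hms0]; exact hΦd.hasFDerivAt
        exact HasFDerivAt.comp (g := Φ) (κ 1) h2 h1
      let P : (E' →L[ℝ] ℝ) →L[ℝ] (E' →L[ℝ] ℝ) :=
        (ContinuousLinearMap.compL ℝ E' E' ℝ).flip (Ad (E' := E') (κ.symm s)⁻¹)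
      have hd2 : HasFDerivAt (fun s' => P (Φ s')) (P.comp (fderiv ℝ Φ (κ 1))) (κ 1) :=
        P.hasFDerivAt.comp (κ 1) (hΦ1.differentiableAt one_ne_zero).hasFDerivAt
      have h3 : fderiv ℝ Φ s (fderiv ℝ m (s, κ 1) (0, a)) = P (fderiv ℝ Φ (κ 1) a) :=
        DFunLike.congr_fun (hd1.unique (hd2.congr_of_eventuallyEq hequiv)) a
      rw [hΦ0, map_zero] at h3
      exact h3
    obtain ⟨c, hc, h0, hcv, hc'⟩ := exists_curve_of_fderiv_vectorField_eq_zero hW hl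
    rw [hW0] at hcv
    refine mem_tangentVectors_of_chart hc h0 hcv ?_
    filter_upwards [hc'] with t ht
    refine (mem_coadjointStabilizer_iff_cotangentLift_mem hp).2 (ht.trans ?_)
    simp only [hΦ, hκ, extChartAt_to_inv, cotangentLift_one]
    exact hp

end Tangent

/-! ### Linear algebra at a point of the level set -/

/-- The range of an antisymmetric form on a finite-dimensional space is the annihilator of its
kernel. -/
theorem exists_apply_eq_of_antisymm {V : Type*} [NormedAddCommGroup V] [NormedSpace ℝ V]
    [FiniteDimensional ℝ V] (A : V →L[ℝ] V →L[ℝ] ℝ) (hA : ∀ a b, A a b = -A b a) (θ : V →L[ℝ] ℝ)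
    (hθ : ∀ a, A a = 0 → θ a = 0) : ∃ a, A a = θ := by
  let B : V →ₗ[ℝ] Module.Dual ℝ V := ContinuousLinearMap.coeLM ℝ ∘ₗ A.toLinearMap
  have hB (a : V) (ha : B a = 0) : A a = 0 := by
    ext b
    exact LinearMap.congr_fun ha b
  have h1 : θ.toLinearMap ∈ B.ker.dualAnnihilator := by
    rw [Submodule.mem_dualAnnihilator]
    exact fun a ha => hθ a (hB a ha)
  rw [← LinearMap.range_dualMap_eq_dualAnnihilator_ker] at h1
  obtain ⟨φ, hφ⟩ := h1
  obtain ⟨b, rfl⟩ := (Module.evalEquiv ℝ V).surjective φ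
  refine ⟨-b, ?_⟩
  ext x
  have h2 : A x b = θ x := LinearMap.congr_fun hφ x
  rw [← h2, hA x b]
  simp

section Reduction

variable {E : Type*} [NormedAddCommGroup E] [NormedSpace ℝ E] [FiniteDimensional ℝ E]
  {M : Type*} [TopologicalSpace M] [ChartedSpace E M] [IsManifold 𝓘(ℝ, E) ∞ M]
  {E' : Type*} [NormedAddCommGroup E'] [NormedSpace ℝ E'] [FiniteDimensional ℝ E']
  {G : Type*} [TopologicalSpace G] [ChartedSpace E' G] [Group G] [LieGroup 𝓘(ℝ, E') ∞ G]
  [MulAction G M] [ContMDiffSMul 𝓘(ℝ, E') 𝓘(ℝ, E) ∞ G M]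

omit [FiniteDimensional ℝ E'] in
theorem liftedGenerator_apply (p : Cotangent E M) (a : E') :
    liftedGenerator E' G p a = orbitDeriv E' G p a := by
  have : CompleteSpace E := FiniteDimensional.complete ℝ E
  rw [liftedGenerator_eq]
  rfl

omit [FiniteDimensional ℝ E'] in
/-- The relation `i_{K_a} ω = -d⟨l, a⟩` between the two differentials. -/
theorem standardSymplectic_orbitDeriv (p : Cotangent E M) (a : E') (w : E × (E →L[ℝ] ℝ)) :
    (orbitDeriv E' G p a).2 w.1 - w.2 (orbitDeriv E' G p a).1 = - momentumDeriv E' G p w a := by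
  have : CompleteSpace E := FiniteDimensional.complete ℝ E
  have h := symplecticForm_liftedGenerator (E' := E') (G := G) p a w
  rw [liftedGenerator_apply] at h
  exact (symplecticForm_apply p _ w).symm.trans h

omit [FiniteDimensional ℝ E] in
theorem isHamiltonianVector_iff (f : Cotangent E M → ℝ) (p : Cotangent E M)
    (K : E × (E →L[ℝ] ℝ)) :
    IsHamiltonianVector f p K ↔ ∀ w : E × (E →L[ℝ] ℝ), K.2 w.1 - w.2 K.1 =
      (-mfderiv (cotangentModel E) 𝓘(ℝ, ℝ) f p : E × (E →L[ℝ] ℝ) →L[ℝ] ℝ) w :=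
  forall_congr' fun w => by
    rw [symplecticForm_apply p K w]
    rfl

omit [FiniteDimensional ℝ E'] in
theorem mem_orbitTangent_iff {S : Set G} {p : Cotangent E M} {v : E × (E →L[ℝ] ℝ)} :
    v ∈ orbitTangent E' S p ↔ ∃ a : E', a ∈ tangentVectors 𝓘(ℝ, E') S 1 ∧
      orbitDeriv E' G p a = v := by
  constructor
  · rintro ⟨a, ha, h⟩
    exact ⟨a, ha, (liftedGenerator_apply (E' := E') (G := G) p a).symm.trans h⟩
  · rintro ⟨a, ha, h⟩
    exact ⟨a, ha, (liftedGenerator_apply (E' := E') (G := G) p a).trans h⟩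

/-- An invariant function is constant along the orbits of the stabilizer, so its differential
vanishes on their tangent vectors. -/
theorem mfderiv_orbitDeriv_eq_zero {ξ : E' →L[ℝ] ℝ} {p : Cotangent E M} (hp : p ∈ levelSet G ξ)
    {f : Cotangent E M → ℝ} (hf : MDifferentiableAt (cotangentModel E) 𝓘(ℝ, ℝ) f p)
    (hinv : ∀ g ∈ (coadjointStabilizer ξ : Set G), f (cotangentLift g p) = f p) {a : E'}
    (ha : momentumDeriv E' G p (orbitDeriv E' G p a) = 0) :
    (mfderiv (cotangentModel E) 𝓘(ℝ, ℝ) f p : E × (E →L[ℝ] ℝ) →L[ℝ] ℝ) (orbitDeriv E' G p a) =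
      0 := by
  have : CompleteSpace E := FiniteDimensional.complete ℝ E
  obtain ⟨γ, h0, hS, hγ⟩ := exists_curve_of_mem_tangentVectors
    ((tangentVectors_coadjointStabilizer hp a).2 ha)
  have h1 := hasMFDerivAt_comp_of_eq (hasMFDerivAt_comp_of_eq hf.hasMFDerivAt
    (hasMFDerivAt_cotangentLift (E' := E') (G := G) p) (cotangentLift_one p)) hγ h0
  exact apply_eq_zero_of_hasMFDerivAt_of_eventually_eq
    (A := ContinuousLinearMap.comp (mfderiv (cotangentModel E) 𝓘(ℝ, ℝ) f p) (orbitDeriv E' G p))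
    h1 (hS.mono fun t ht => hinv (γ t) ht)

end Reduction

end CotangentReduction

end

open CotangentReduction in
theorem mainTheorem7
    {E : Type*} [NormedAddCommGroup E] [NormedSpace ℝ E] [FiniteDimensional ℝ E]
    {M : Type*} [TopologicalSpace M] [ChartedSpace E M] [IsManifold 𝓘(ℝ, E) ∞ M]
    {E' : Type*} [NormedAddCommGroup E'] [NormedSpace ℝ E'] [FiniteDimensional ℝ E']
    {G : Type*} [TopologicalSpace G] [ChartedSpace E' G] [Group G] [LieGroup 𝓘(ℝ, E') ∞ G]
    [MulAction G M] [ContMDiffSMul 𝓘(ℝ, E') 𝓘(ℝ, E) ∞ G M]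
    (ξ : E' →L[ℝ] ℝ) (hξ : CotangentReduction.IsRegularValue E M G ξ)
    (U : Set (CotangentReduction.Cotangent E M)) (hU : IsOpen U)
    (hMU : CotangentReduction.levelSet G ξ ⊆ U)
    (f : CotangentReduction.Cotangent E M → ℝ)
    (hf : ContMDiffOn (CotangentReduction.cotangentModel E) 𝓘(ℝ, ℝ) ∞ f U)
    (hinv : ∀ g ∈ (CotangentReduction.coadjointStabilizer ξ : Set G),
      ∀ q ∈ CotangentReduction.levelSet G ξ, f (CotangentReduction.cotangentLift g q) = f q)
    (p : CotangentReduction.Cotangent E M) (hp : p ∈ CotangentReduction.levelSet G ξ) :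
    (∃! K, CotangentReduction.IsHamiltonianVector f p K) ∧
    ∀ K, CotangentReduction.IsHamiltonianVector f p K →
      ∃ V ∈ CotangentReduction.orbitTangent E' (univ : Set G) p,
        K + V ∈ CotangentReduction.tangentVectors (CotangentReduction.cotangentModel E)
          (CotangentReduction.levelSet G ξ) p ∧
        ∀ V' ∈ CotangentReduction.orbitTangent E' (univ : Set G) p,
          K + V' ∈ CotangentReduction.tangentVectors (CotangentReduction.cotangentModel E)
              (CotangentReduction.levelSet G ξ) p ↔
            V' - V ∈ CotangentReduction.orbitTangent E'
              (CotangentReduction.coadjointStabilizer ξ : Set G) p := by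
  set L := momentumDeriv E' G p with hL
  set T := orbitDeriv E' G p with hT
  set θ : E × (E →L[ℝ] ℝ) →L[ℝ] ℝ := mfderiv (cotangentModel E) 𝓘(ℝ, ℝ) f p with hθ
  have hsurj : Function.Surjective L := by
    have h := hξ p hp
    rwa [(hasMFDerivAt_momentumMap p).mfderiv] at h
  have hfp : MDifferentiableAt (cotangentModel E) 𝓘(ℝ, ℝ) f p :=
    (hf.contMDiffAt (hU.mem_nhds (hMU hp))).mdifferentiableAt (by simp)
  refine ⟨?_, fun K hK => ?_⟩
  · obtain ⟨K, hK, huniq⟩ := existsUnique_standardSymplectic_eq (-θ)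
    exact ⟨K, (isHamiltonianVector_iff f p K).2 hK,
      fun K' hK' => huniq K' ((isHamiltonianVector_iff f p K').1 hK')⟩
  · change E × (E →L[ℝ] ℝ) at K
    rw [isHamiltonianVector_iff] at hK
    have hω (a : E') (w : E × (E →L[ℝ] ℝ)) : (T a).2 w.1 - w.2 (T a).1 = - L w a :=
      standardSymplectic_orbitDeriv p a w
    -- `dl(K_a)(b) = ω(K_a, K_b)` is antisymmetric in `a` and `b`
    have hanti (a b : E') : L (T a) b = - L (T b) a := by
      linarith [hω a (T b), hω b (T a)]
    -- `dl(K_f)(a) = ω(K_f, K_a) = -df(K_a)` vanishes for `a` tangent to the stabilizer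
    have hLK (a : E') (ha : L (T a) = 0) : L K a = 0 := by
      have h1 : K.2 (T a).1 - (T a).2 K.1 = -θ (T a) := hK (T a)
      have h2 : θ (T a) = 0 :=
        mfderiv_orbitDeriv_eq_zero hp hfp (fun g hg => hinv g hg p hp) ha
      rw [h2] at h1
      linarith [hω a K]
    -- hence `-dl(K_f)` is in the range of `a ↦ dl(K_a)`, and `V_f = K_a` for a preimage `a`
    obtain ⟨a, ha⟩ := exists_apply_eq_of_antisymm (L.comp T) hanti (-L K)
      (fun a ha => by simp [hLK a ha])
    have hmem (v : E × (E →L[ℝ] ℝ)) := tangentVectors_levelSet (v := v) hp hsurj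
    have hstab := tangentVectors_coadjointStabilizer hp
    have ha' : L K + L (T a) = 0 := by
      have h : L (T a) = -L K := ha
      rw [h, add_neg_cancel]
    refine ⟨T a, mem_orbitTangent_iff.2 ⟨a, tangentVectors_univ a, rfl⟩,
      (hmem (K + T a)).2 ((map_add L K (T a)).trans ha'), ?_⟩
    intro V' hV'
    obtain ⟨a', -, rfl⟩ := mem_orbitTangent_iff.1 hV'
    have hsub : L K + L (T a') = L (T a' - T a) := by
      rw [map_sub, ← add_sub_add_left_eq_sub (L (T a')) (L (T a)) (L K), ha', sub_zero]
    have hiff : L (K + T a') = 0 ↔ L (T a' - T a) = 0 := by rw [map_add, hsub]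
    refine (hmem (K + T a')).trans (hiff.trans ?_)
    -- a vector `K_b` of the orbit is in the kernel of `dl` exactly if `b` is tangent to `G_ξ`
    constructor
    · intro h
      rw [← map_sub] at h
      exact mem_orbitTangent_iff.2 ⟨a' - a, (hstab (a' - a)).2 h, map_sub T a' a⟩
    · intro h
      obtain ⟨b, hb, hbV⟩ := mem_orbitTangent_iff.1 h
      have h1 := (hstab b).1 hb
      rw [hbV] at h1
      exact h1
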